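/- Let $n\ge 0$ and let $\omega((P,Q),(P',Q'))=\sum_{j=1}^n(P_jQ'_j-P'_jQ_j)$ be the symplectic form on $\mathbb R^{2n}=\{(P,Q)\mid P,Q\in\mathbb R^n\}$, extended complex-bilinearly to $\mathbb C^{2n}$. Let $\mathcal L\subset\mathbb R^{2n}$ be an isotropic linear subspace (that is, $\omega(X,X')=0$ for all $X,X'\in\mathcal L$), with a translation-invariant (Haar) measure $\mu$. For $Y=(P,Q)\in\mathbb C^{2n}$ let $$\Omega(Y)=\sum_{j=1}^n\Bigl(P_j\xi_j-Q_j\tfrac1i\tfrac{\partial}{\partial\xi_j}\Bigr)$$ act on the Schwartz space $\mathcal S(\mathbb R^n)$; for real $X=(P,Q)$ one has $(e^{i\Omega(X)}\varphi)(\xi)=e^{iP\cdot\xi-\frac i2P\cdot Q}\varphi(\xi-Q)$. On $\mathcal S(\mathbb R^n)$ consider the (degenerate) inner product $$\langle\varphi,\psi\rangle=\int_{\mathcal L}d\mu(X)\,(\varphi,e^{i\Omega(X)}\psi),\qquad (\varphi,\psi)=\int_{\mathbb R^n}\overline{\varphi(\xi)}\,\psi(\xi)\,d\xi,$$ with $\|\varphi\|^2=\langle\varphi,\varphi\rangle$,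 and write $\varphi\sim\psi$ if $\|\varphi-\psi\|=0$, that is, if $\varphi$ and $\psi$ define the same vector of the constrained Hilbert space $\overline{\mathcal S(\mathbb R^n)/\!\sim}$. For a complex $n\times n$ matrix $A$ with $\operatorname{Im}\sum_{jk}\xi_jA_{jk}\xi_k>0$ for all $\xi\in\mathbb R^n\setminus\{0\}$, put $\psi_A(\xi)=e^{\frac i2\sum_{jk}\xi_jA_{jk}\xi_k}\in\mathcal S(\mathbb R^n)$ and define the H-germ of $A$ as $$\check r(A)=\{Y\in\mathbb C^{2n}\mid \omega(Y,X)=0\ \text{for all } X\in\mathcal L,\ \text{and } \|\Omega(Y)\psi_A\|=0\}.$$ Let $A^I,A^{II}$ be two such matrices, $c^I,c^{II}\in\mathbb C\setminus\{0\}$, and $\psi^I=c^I\psi_{A^I}$, $\psi^{II}=c^{II}\psi_{A^{II}}$ the corresponding Gaussian states. Then $\check r(A^I)=\check r(A^{II})$ if and only if $\psi^I\sim c\,\psi^{II}$ for some $c\in\mathbb C$. -/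

import Mathlib

open MeasureTheory SchwartzMap
open scoped ComplexConjugate

noncomputable section

namespace Constrained

/-- The phase space `R^{2n}`: a point is a pair `X = (P, Q)`, momenta first. -/
abbrev Phase (R : Type) (n : ℕ) : Type := (Fin n → R) × (Fin n → R)

/-- The embedding of the real phase space into the complexified one. -/
def Phase.toComplex {n : ℕ} (X : Phase ℝ n) : Phase ℂ n :=
  (fun j => (X.1 j : ℂ), fun j => (X.2 j : ℂ))

/-- The symplectic form `ω((P, Q), (P', Q')) = ∑ⱼ (Pⱼ Q'ⱼ - P'ⱼ Qⱼ)`, real or complex bilinear. -/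
def omega {R : Type} [CommRing R] {n : ℕ} (X X' : Phase R n) : R :=
  ∑ j, (X.1 j * X'.2 j - X'.1 j * X.2 j)

/-- An isotropic plane of the real phase space. -/
def IsIsotropic {n : ℕ} (L : Submodule ℝ (Phase ℝ n)) : Prop :=
  ∀ X ∈ L, ∀ X' ∈ L, omega X X' = 0

/-- The coordinate operator `φ ↦ ξⱼ φ` on Schwartz functions. -/
def coordOp {n : ℕ} (j : Fin n) : 𝓢(Fin n → ℝ, ℂ) →L[ℂ] 𝓢(Fin n → ℝ, ℂ) :=
  SchwartzMap.smulLeftCLM ℂ (fun ξ : Fin n → ℝ => (ξ j : ℂ))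

/-- The partial derivative `∂ / ∂ξⱼ` on Schwartz functions. -/
def partialOp {n : ℕ} (j : Fin n) : 𝓢(Fin n → ℝ, ℂ) →L[ℂ] 𝓢(Fin n → ℝ, ℂ) :=
  LineDeriv.lineDerivOpCLM ℂ 𝓢(Fin n → ℝ, ℂ) (Pi.single j 1 : Fin n → ℝ)

/-- `Ω(P, Q) = ∑ⱼ (Pⱼ ξⱼ - Qⱼ (1/i) ∂ⱼ)` for `(P, Q)` in the complexified phase space. -/
def Omega {n : ℕ} (Y : Phase ℂ n) : 𝓢(Fin n → ℝ, ℂ) →L[ℂ] 𝓢(Fin n → ℝ, ℂ) :=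
  ∑ j, (Y.1 j • coordOp j - (Y.2 j * (1 / Complex.I)) • partialOp j)

theorem coord_temperate {n : ℕ} (j : Fin n) :
    Function.HasTemperateGrowth (fun ξ : Fin n → ℝ => (ξ j : ℂ)) :=
  (Complex.ofRealCLM.comp (ContinuousLinearMap.proj (R := ℝ) (φ := fun _ => ℝ) j)).hasTemperateGrowth

theorem Omega_apply {n : ℕ} (Y : Phase ℂ n) (φ : 𝓢(Fin n → ℝ, ℂ)) (ξ : Fin n → ℝ) :
    Omega Y φ ξ = ∑ j, (Y.1 j * ((ξ j : ℂ) * φ ξ)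
      - Y.2 j * (1 / Complex.I) * fderiv ℝ φ ξ (Pi.single j 1)) := by
  simp only [Omega, sum_apply]
  refine Finset.sum_congr rfl fun j _ => ?_
  simp only [sub_apply, smul_apply, smul_eq_mul, coordOp, partialOp]
  rw [SchwartzMap.smulLeftCLM_apply_apply (coord_temperate j)]
  rfl

/-- The unitary group `e^{iΩ(X)}` for real `X = (P, Q)`:
`(e^{iΩ(X)} φ)(ξ) = e^{i P·ξ - (i/2) P·Q} φ(ξ - Q)`. -/
def weyl {n : ℕ} (X : Phase ℝ n) (φ : (Fin n → ℝ) → ℂ) : (Fin n → ℝ) → ℂ := fun ξ =>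
  Complex.exp (Complex.I * ((∑ j, X.1 j * ξ j - (∑ j, X.1 j * X.2 j) / 2 : ℝ) : ℂ)) * φ (ξ - X.2)

/-- `e^{iΩ(X)} e^{iΩ(X')} = e^{iΩ(X + X')} e^{(i/2) ω(X, X')}`. -/
theorem weyl_weyl {n : ℕ} (X X' : Phase ℝ n) (φ : (Fin n → ℝ) → ℂ) (ξ : Fin n → ℝ) :
    weyl X (weyl X' φ) ξ
      = Complex.exp (Complex.I / 2 * ((omega X X' : ℝ) : ℂ)) * weyl (X + X') φ ξ := by
  simp only [weyl, omega]
  rw [← mul_assoc, ← mul_assoc, ← Complex.exp_add, ← Complex.exp_add]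
  congr 2
  · push_cast
    simp only [Prod.fst_add, Prod.snd_add, Pi.add_apply, Pi.sub_apply, Complex.ofReal_add,
      Complex.ofReal_sub, add_mul, mul_add, mul_sub, Finset.sum_add_distrib,
      Finset.sum_sub_distrib]
    ring
  · simp only [Prod.snd_add]
    abel

/-- The generator of `t ↦ e^{itΩ(X)}` is `iΩ(X)`. -/
theorem weyl_hasDerivAt {n : ℕ} (X : Phase ℝ n) (φ : 𝓢(Fin n → ℝ, ℂ)) (ξ : Fin n → ℝ) :
    HasDerivAt (fun t : ℝ => weyl (t • X) φ ξ) (Complex.I * Omega X.toComplex φ ξ) 0 := by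
  have h1 : HasDerivAt (fun t : ℝ =>
      t * ∑ j, X.1 j * ξ j - t ^ 2 * ((∑ j, X.1 j * X.2 j) / 2)) (∑ j, X.1 j * ξ j) 0 := by
    have := ((hasDerivAt_id (0 : ℝ)).mul_const (∑ j, X.1 j * ξ j)).sub
      ((hasDerivAt_pow 2 (0 : ℝ)).mul_const ((∑ j, X.1 j * X.2 j) / 2))
    refine this.congr_deriv ?_
    simp
  have h2 := (h1.ofReal_comp.const_mul Complex.I).cexp
  have h3 : HasDerivAt (fun t : ℝ => ξ - t • X.2) (-X.2) 0 := by
    simpa using ((hasDerivAt_id (0 : ℝ)).smul_const X.2).const_sub ξ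
  have h4 : HasDerivAt (fun t : ℝ => φ (ξ - t • X.2)) (fderiv ℝ φ ξ (-X.2)) 0 := by
    have hφ : HasFDerivAt φ (fderiv ℝ φ ξ) (ξ - (0 : ℝ) • X.2) := by
      simpa using φ.hasFDerivAt ξ
    exact hφ.comp_hasDerivAt (0 : ℝ) h3
  have h5 : fderiv ℝ φ ξ X.2 = ∑ j, (X.2 j : ℂ) * fderiv ℝ φ ξ (Pi.single j 1) := by
    conv_lhs => rw [pi_eq_sum_univ' X.2]
    simp [map_sum, Pi.single]
  have h6 : (fun t : ℝ => weyl (t • X) φ ξ) = fun t : ℝ => Complex.exp (Complex.I *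
      ((t * ∑ j, X.1 j * ξ j - t ^ 2 * ((∑ j, X.1 j * X.2 j) / 2) : ℝ) : ℂ)) * φ (ξ - t • X.2) := by
    funext t
    simp only [weyl, Prod.smul_fst, Prod.smul_snd, Pi.smul_apply, smul_eq_mul]
    congr 5
    · rw [Finset.mul_sum]
      exact Finset.sum_congr rfl fun j _ => by ring
    · rw [Finset.sum_div, Finset.sum_div, Finset.mul_sum]
      exact Finset.sum_congr rfl fun j _ => by ring
  rw [h6]
  refine (h2.mul h4).congr_deriv ?_
  rw [Omega_apply, map_neg, h5]
  simp only [Phase.toComplex, Finset.mul_sum, zero_mul,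
    ne_eq, OfNat.ofNat_ne_zero, not_false_eq_true, zero_pow, Complex.ofReal_zero,
    mul_zero, Complex.exp_zero, one_mul, zero_smul, Complex.ofReal_sum, Complex.ofReal_mul,
    Finset.sum_mul, sub_eq_add_neg, ← Finset.sum_neg_distrib, neg_zero, add_zero,
    Finset.sum_const_zero]
  rw [← Finset.sum_add_distrib]
  refine Finset.sum_congr rfl fun j _ => ?_
  have hI := Complex.I_ne_zero
  field_simp

/-- The inner product `(f, g) = ∫ f̄ g dξ`. -/
def l2Inner {n : ℕ} (f g : (Fin n → ℝ) → ℂ) : ℂ := ∫ ξ, conj (f ξ) * g ξ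

/-- The inner product of the constrained system, `⟨f, g⟩ = ∫_L (f, e^{iΩ(X)} g) dμ(X)`. -/
def physInner {n : ℕ} (L : Submodule ℝ (Phase ℝ n)) (μ : Measure L)
    (f g : 𝓢(Fin n → ℝ, ℂ)) : ℂ :=
  ∫ X : L, l2Inner f (weyl (X : Phase ℝ n) g) ∂μ

/-- `f ∼ 0`: the vector has zero norm, `⟨f, f⟩ = 0`. -/
def IsNull {n : ℕ} (L : Submodule ℝ (Phase ℝ n)) (μ : Measure L) (f : 𝓢(Fin n → ℝ, ℂ)) : Prop :=
  physInner L μ f f = 0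

/-- `f ∼ g`: the two wave functions give the same vector of the constrained Hilbert space. -/
def PhysEquiv {n : ℕ} (L : Submodule ℝ (Phase ℝ n)) (μ : Measure L)
    (f g : 𝓢(Fin n → ℝ, ℂ)) : Prop :=
  IsNull L μ (f - g)

/-- The quadratic form `∑_{jk} ξⱼ A_{jk} ξ_k`. -/
def quad {n : ℕ} (A : Matrix (Fin n) (Fin n) ℂ) (ξ : Fin n → ℝ) : ℂ :=
  ∑ j, ∑ k, (ξ j : ℂ) * A j k * (ξ k : ℂ)

/-- The condition on `A` under which `exp((i/2) ∑ ξⱼ A_{jk} ξ_k)` is a Schwartz function: its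
imaginary part is a positive definite quadratic form. -/
def ImPos {n : ℕ} (A : Matrix (Fin n) (Fin n) ℂ) : Prop :=
  ∀ ξ : Fin n → ℝ, ξ ≠ 0 → 0 < (quad A ξ).im

/-- The exponent `(i/2) ∑ ξⱼ A_{jk} ξ_k`. -/
def gaussExponent {n : ℕ} (A : Matrix (Fin n) (Fin n) ℂ) (ξ : Fin n → ℝ) : ℂ :=
  Complex.I / 2 * quad A ξ

theorem gaussExponent_temperate {n : ℕ} (A : Matrix (Fin n) (Fin n) ℂ) :
    (gaussExponent A).HasTemperateGrowth := by
  unfold gaussExponent quad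
  refine (Function.HasTemperateGrowth.const _).mul ?_
  refine Function.HasTemperateGrowth.sum fun j _ => Function.HasTemperateGrowth.sum fun k _ => ?_
  exact ((coord_temperate j).mul (Function.HasTemperateGrowth.const _)).mul (coord_temperate k)

theorem quad_smul {n : ℕ} (A : Matrix (Fin n) (Fin n) ℂ) (r : ℝ) (ξ : Fin n → ℝ) :
    quad A (r • ξ) = (r : ℂ) ^ 2 * quad A ξ := by
  simp only [quad, Finset.mul_sum, Pi.smul_apply, smul_eq_mul, Complex.ofReal_mul]
  refine Finset.sum_congr rfl fun j _ => Finset.sum_congr rfl fun k _ => by ring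

theorem gaussExponent_re_le {n : ℕ} {A : Matrix (Fin n) (Fin n) ℂ} (hA : ImPos A) :
    ∃ ε > 0, ∀ ξ, (gaussExponent A ξ).re ≤ -ε * ‖ξ‖ ^ 2 := by
  have hre : ∀ ξ, (gaussExponent A ξ).re = -(quad A ξ).im / 2 := fun ξ => by
    simp [gaussExponent, Complex.mul_re]
    ring
  have hq0 : quad A 0 = 0 := by simp [quad]
  rcases (Metric.sphere (0 : Fin n → ℝ) 1).eq_empty_or_nonempty with he | hne
  · refine ⟨1, one_pos, fun ξ => ?_⟩
    have : ξ = 0 := by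
      by_contra h
      have : ‖ξ‖⁻¹ • ξ ∈ Metric.sphere (0 : Fin n → ℝ) 1 := by
        simp [norm_smul, norm_ne_zero_iff.2 h]
      simp [he] at this
    simp [this, hre, hq0]
  · have hc : Continuous fun ξ => (quad A ξ).im := by
      unfold quad
      fun_prop
    obtain ⟨x, hx, hmin⟩ := (isCompact_sphere (0 : Fin n → ℝ) 1).exists_isMinOn hne hc.continuousOn
    have hx0 : x ≠ 0 := by
      rintro rfl
      simp at hx
    refine ⟨(quad A x).im / 2, half_pos (hA x hx0), fun ξ => ?_⟩
    by_cases h : ξ = 0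
    · simp [h, hre, hq0]
    have hn := norm_ne_zero_iff.2 h
    have hs : ‖ξ‖⁻¹ • ξ ∈ Metric.sphere (0 : Fin n → ℝ) 1 := by simp [norm_smul, hn]
    have h1 : (quad A x).im ≤ (quad A (‖ξ‖⁻¹ • ξ)).im := hmin hs
    have h2 : (quad A ξ).im = ‖ξ‖ ^ 2 * (quad A (‖ξ‖⁻¹ • ξ)).im := by
      conv_lhs => rw [← one_smul ℝ ξ, ← mul_inv_cancel₀ hn, ← smul_smul, quad_smul]
      rw [← Complex.ofReal_pow, Complex.im_ofReal_mul]
    rw [hre, h2]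
    nlinarith [mul_le_mul_of_nonneg_left h1 (sq_nonneg ‖ξ‖)]

theorem norm_iteratedFDeriv_cexp (i : ℕ) (z : ℂ) :
    ‖iteratedFDeriv ℝ i Complex.exp z‖
      = ‖Complex.exp z‖ * ‖iteratedFDeriv ℝ i Complex.exp 0‖ := by
  have h : Complex.exp = fun w => Complex.exp z • Complex.exp (w - z) := by
    funext w
    rw [smul_eq_mul, ← Complex.exp_add]
    congr 1
    ring
  have hc : ContDiff ℝ i fun w : ℂ => Complex.exp (w - z) := by fun_prop
  conv_lhs => rw [h]
  rw [iteratedFDeriv_const_smul_apply' hc.contDiffAt, norm_smul, iteratedFDeriv_comp_sub, sub_self]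

theorem one_add_pow_mul_exp_le (N : ℕ) {ε r : ℝ} (hε : 0 < ε) (hr : 0 ≤ r) :
    (1 + r) ^ N * Real.exp (-ε * r ^ 2) ≤ N.factorial * Real.exp (1 + 1 / (4 * ε)) := by
  have h1 : (1 + r) ^ N ≤ N.factorial * Real.exp (1 + r) := by
    have := Real.pow_div_factorial_le_exp (1 + r) (by positivity) N
    rwa [div_le_iff₀ (by positivity), mul_comm] at this
  have h2 : 1 + r + -ε * r ^ 2 ≤ 1 + 1 / (4 * ε) := by
    have : 1 / (4 * ε) - r + ε * r ^ 2 = (2 * ε * r - 1) ^ 2 / (4 * ε) := by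
      field_simp
      ring
    have h3 : 0 ≤ (2 * ε * r - 1) ^ 2 / (4 * ε) := by positivity
    linarith
  calc (1 + r) ^ N * Real.exp (-ε * r ^ 2)
      ≤ N.factorial * Real.exp (1 + r) * Real.exp (-ε * r ^ 2) := by gcongr
    _ = N.factorial * Real.exp (1 + r + -ε * r ^ 2) := by rw [mul_assoc, ← Real.exp_add]
    _ ≤ _ := by gcongr

theorem gauss_decay {n : ℕ} {A : Matrix (Fin n) (Fin n) ℂ} (hA : ImPos A) (k m : ℕ) :
    ∃ C : ℝ, ∀ ξ, ‖ξ‖ ^ k *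
      ‖iteratedFDeriv ℝ m (fun ξ => Complex.exp (gaussExponent A ξ)) ξ‖ ≤ C := by
  obtain ⟨ε, hε, hre⟩ := gaussExponent_re_le hA
  obtain ⟨l, D, hD0, hD⟩ := (gaussExponent_temperate A).norm_iteratedFDeriv_le_uniform m
  set K : ℝ := ∑ i ∈ Finset.range (m + 1), ‖iteratedFDeriv ℝ i Complex.exp 0‖ with hK
  refine ⟨m.factorial * K * (1 + D) ^ m *
    ((k + l * m).factorial * Real.exp (1 + 1 / (4 * ε))), fun ξ => ?_⟩
  have hK0 : 0 ≤ K := Finset.sum_nonneg fun _ _ => norm_nonneg _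
  have h1 : (1 : ℝ) ≤ (1 + ‖ξ‖) ^ l := one_le_pow₀ (by linarith [norm_nonneg ξ])
  have hmain := norm_iteratedFDeriv_comp_le (𝕜 := ℝ) (g := Complex.exp) (f := gaussExponent A)
    (n := m) (N := m) (by fun_prop)
    ((gaussExponent_temperate A).1.of_le (by exact_mod_cast le_top)) le_rfl ξ
    (C := K * Real.exp (-ε * ‖ξ‖ ^ 2)) (D := (1 + D) * (1 + ‖ξ‖) ^ l)
    (fun i hi => by
      rw [norm_iteratedFDeriv_cexp, mul_comm]
      refine mul_le_mul ?_ ?_ (norm_nonneg _) hK0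
      · exact Finset.single_le_sum (f := fun i => ‖iteratedFDeriv ℝ i Complex.exp (0 : ℂ)‖)
          (fun _ _ => norm_nonneg _) (Finset.mem_range.2 (by omega))
      · rw [Complex.norm_exp]
        exact Real.exp_le_exp.2 (hre ξ))
    (fun i hi him => by
      refine (hD i him ξ).trans ?_
      have h2 : D * (1 + ‖ξ‖) ^ l ≤ (1 + D) * (1 + ‖ξ‖) ^ l := by
        gcongr
        linarith
      refine h2.trans (le_self_pow₀ ?_ (by omega))
      nlinarith)
  have hexp := one_add_pow_mul_exp_le (k + l * m) hε (norm_nonneg ξ)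
  calc ‖ξ‖ ^ k * ‖iteratedFDeriv ℝ m (fun ξ => Complex.exp (gaussExponent A ξ)) ξ‖
      ≤ (1 + ‖ξ‖) ^ k * (m.factorial * (K * Real.exp (-ε * ‖ξ‖ ^ 2)) *
          ((1 + D) * (1 + ‖ξ‖) ^ l) ^ m) := by
        refine mul_le_mul ?_ hmain (norm_nonneg _) (by positivity)
        gcongr
        linarith
    _ = m.factorial * K * (1 + D) ^ m *
          ((1 + ‖ξ‖) ^ (k + l * m) * Real.exp (-ε * ‖ξ‖ ^ 2)) := by
        rw [mul_pow, ← pow_mul, pow_add]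
        ring
    _ ≤ _ := by gcongr

/-- The Gaussian wave function `ψ_A(ξ) = exp((i/2) ∑ ξⱼ A_{jk} ξ_k)` as a Schwartz function. -/
def gaussian {n : ℕ} (A : Matrix (Fin n) (Fin n) ℂ) (hA : ImPos A) : 𝓢(Fin n → ℝ, ℂ) where
  toFun ξ := Complex.exp (Complex.I / 2 * ∑ j, ∑ k, (ξ j : ℂ) * A j k * (ξ k : ℂ))
  smooth' := Complex.contDiff_exp.comp (gaussExponent_temperate A).1
  decay' k m := gauss_decay hA k m

/-- The H-germ of `ψ_A`: all complex `Y` that are skew-orthogonal to `L`, so that `Ω(Y)` is an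
operator of the constrained theory, with `‖Ω(Y) ψ_A‖ = 0`. By linearity,
skew-orthogonality to `L` is the same as skew-orthogonality to its complexification. -/
def hGerm {n : ℕ} (L : Submodule ℝ (Phase ℝ n)) (μ : Measure L)
    (A : Matrix (Fin n) (Fin n) ℂ) (hA : ImPos A) : Set (Phase ℂ n) :=
  {Y | (∀ X ∈ L, omega Y X.toComplex = 0) ∧ IsNull L μ (Omega Y (gaussian A hA))}

end Constrained

end

/-!
The form `⟨·, ·⟩` is a semi-inner product, because averaging the positive definite function
`X ↦ (φ, e^{iΩ(X)} φ)` over large balls of `L` gives a nonnegative number. For `Y` skew-orthogonal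
to `L` the operator `Ω(Y)` descends to the constrained Hilbert space, with adjoint `Ω(Ȳ)`;
equivalent states are therefore annihilated by the same operators and have the same germ.

Conversely, the H-germ of `A` contains the complexification of `L` and the part of the Lagrangian
plane `P = AQ` that is skew-orthogonal to `L`. As the Hermitian form `-i ω(Y, Ȳ)` is definite on
that plane, a dimension count shows that for every `Z` there is a `Y` in the germ with
`Ω(Z) ψ_A = Ω(Ȳ) ψ_A`. If the germ annihilates `f`, then `h(t) = ⟨e^{itΩ(Z)} ψ_A, f⟩`
solves a linear equation `h' = t κ h`, so an `f` orthogonal to `ψ_A` is orthogonal to all coherent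
states `e^{iΩ(Z)} ψ_A`, hence null by Moyal's identity. A germ inclusion thus makes
`f = ψ - b ψ_A` null for the right scalar `b`.
-/

noncomputable section

namespace Constrained

variable {n : ℕ}

/-! ### The symplectic form -/

section Omega

variable {R : Type} [CommRing R]

theorem omega_add_left (X X' Z : Phase R n) : omega (X + X') Z = omega X Z + omega X' Z := by
  simp only [omega, Prod.fst_add, Prod.snd_add, Pi.add_apply, ← Finset.sum_add_distrib]
  exact Finset.sum_congr rfl fun j _ => by ring

theorem omega_smul_left (c : R) (X X' : Phase R n) : omega (c • X) X' = c * omega X X' := by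
  simp only [omega, Prod.smul_fst, Prod.smul_snd, Pi.smul_apply, smul_eq_mul, Finset.mul_sum]
  exact Finset.sum_congr rfl fun j _ => by ring

theorem omega_swap (X X' : Phase R n) : omega X X' = -omega X' X := by
  simp only [omega, ← Finset.sum_neg_distrib]
  exact Finset.sum_congr rfl fun j _ => by ring

theorem omega_add_right (X Z Z' : Phase R n) : omega X (Z + Z') = omega X Z + omega X Z' := by
  rw [omega_swap, omega_add_left, neg_add, ← omega_swap, ← omega_swap]

theorem omega_smul_right (c : R) (X X' : Phase R n) : omega X (c • X') = c * omega X X' := by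
  rw [omega_swap, omega_smul_left, ← mul_neg, ← omega_swap]

theorem omega_neg_left (X X' : Phase R n) : omega (-X) X' = -omega X X' := by
  rw [← neg_one_smul R X, omega_smul_left, neg_one_mul]

theorem omega_self (X : Phase R n) : omega X X = 0 := by
  simp [omega]

end Omega

theorem Phase.toComplex_smul (t : ℝ) (Z : Phase ℝ n) :
    (t • Z).toComplex = (t : ℂ) • Z.toComplex := by
  ext j <;> simp [Phase.toComplex]

theorem omega_toComplex (X X' : Phase ℝ n) : omega X.toComplex X'.toComplex = omega X X' := by
  simp [omega, Phase.toComplex]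

/-- Complex conjugation on the complexified phase space. -/
def Phase.conj (Y : Phase ℂ n) : Phase ℂ n :=
  (fun j => starRingEnd ℂ (Y.1 j), fun j => starRingEnd ℂ (Y.2 j))

theorem Phase.conj_conj (Y : Phase ℂ n) : Y.conj.conj = Y := by
  simp [Phase.conj]

theorem Phase.conj_zero : (0 : Phase ℂ n).conj = 0 := by
  ext j <;> simp [Phase.conj]

theorem Phase.conj_add (Y Z : Phase ℂ n) : (Y + Z).conj = Y.conj + Z.conj := by
  ext j <;> simp [Phase.conj]

theorem Phase.conj_smul (c : ℂ) (Y : Phase ℂ n) : (c • Y).conj = conj c • Y.conj := by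
  ext j <;> simp [Phase.conj]

theorem Phase.conj_toComplex (X : Phase ℝ n) : X.toComplex.conj = X.toComplex := by
  simp [Phase.conj, Phase.toComplex]

theorem omega_conj (Y Z : Phase ℂ n) : omega Y.conj Z.conj = conj (omega Y Z) := by
  simp [omega, Phase.conj]

/-- The skew-orthogonal complement of `L` in the complexified phase space. The operators `Ω(Y)`
with `Y` in it are the ones that commute with the constraints. -/
def skewComplement (L : Submodule ℝ (Phase ℝ n)) : Submodule ℂ (Phase ℂ n) where
  carrier := {Y | ∀ X ∈ L, omega Y X.toComplex = 0}
  add_mem' hY hZ X hX := by rw [omega_add_left, hY X hX, hZ X hX, add_zero]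
  zero_mem' X _ := by simp [omega]
  smul_mem' c Y hY X hX := by rw [omega_smul_left, hY X hX, mul_zero]

theorem conj_mem_skewComplement {L : Submodule ℝ (Phase ℝ n)} {Y : Phase ℂ n}
    (hY : Y ∈ skewComplement L) : Y.conj ∈ skewComplement L := fun X hX => by
  rw [← Phase.conj_toComplex, omega_conj, hY X hX, map_zero]

/-! ### The Weyl operators on Schwartz space -/

theorem hasTemperateGrowth_cexp_I_mul :
    Function.HasTemperateGrowth fun t : ℝ => Complex.exp (Complex.I * t) := by
  let ℓ : ℝ →L[ℝ] ℂ := Complex.I • Complex.ofRealCLM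
  refine ⟨Complex.contDiff_exp.comp ℓ.contDiff, fun k =>
    ⟨0, ‖iteratedFDeriv ℝ k Complex.exp 0‖ * ∏ _i : Fin k, ‖ℓ‖, fun t => ?_⟩⟩
  have hcomp : iteratedFDeriv ℝ k (fun t : ℝ => Complex.exp (Complex.I * t)) t
      = (iteratedFDeriv ℝ k Complex.exp (ℓ t)).compContinuousLinearMap fun _ => ℓ :=
    ℓ.iteratedFDeriv_comp_right (f := Complex.exp) Complex.contDiff_exp t le_rfl
  have hexp : ‖Complex.exp (ℓ t)‖ = 1 := by
    rw [← Complex.norm_exp_ofReal_mul_I t, mul_comm]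
    rfl
  rw [hcomp, pow_zero, mul_one]
  refine (ContinuousMultilinearMap.norm_compContinuousLinearMap_le _ _).trans_eq ?_
  rw [norm_iteratedFDeriv_cexp, hexp, one_mul]

/-- The phase factor `e^{i P·ξ - (i/2) P·Q}` of the Weyl operator `e^{iΩ(P, Q)}`. -/
def weylPhase (X : Phase ℝ n) (ξ : Fin n → ℝ) : ℂ :=
  Complex.exp (Complex.I * ((∑ j, X.1 j * ξ j - (∑ j, X.1 j * X.2 j) / 2 : ℝ) : ℂ))

theorem hasTemperateGrowth_weylPhase (X : Phase ℝ n) : (weylPhase X).HasTemperateGrowth := by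
  have hcoord (j : Fin n) : Function.HasTemperateGrowth fun ξ : Fin n → ℝ => ξ j :=
    (ContinuousLinearMap.proj (R := ℝ) (φ := fun _ : Fin n => ℝ) j).hasTemperateGrowth
  exact hasTemperateGrowth_cexp_I_mul.comp <|
    (Function.HasTemperateGrowth.sum fun j _ =>
      (Function.HasTemperateGrowth.const _).mul (hcoord j)).sub (.const _)

theorem norm_weylPhase (X : Phase ℝ n) (ξ : Fin n → ℝ) : ‖weylPhase X ξ‖ = 1 := by
  rw [weylPhase, mul_comm, Complex.norm_exp_ofReal_mul_I]

/-- The Weyl operator `e^{iΩ(X)}` as a continuous operator on Schwartz space. -/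
def weylOp (X : Phase ℝ n) : 𝓢(Fin n → ℝ, ℂ) →L[ℂ] 𝓢(Fin n → ℝ, ℂ) :=
  SchwartzMap.smulLeftCLM ℂ (weylPhase X) ∘L SchwartzMap.compSubConstCLM ℂ X.2

theorem weylOp_apply (X : Phase ℝ n) (f : 𝓢(Fin n → ℝ, ℂ)) (ξ : Fin n → ℝ) :
    weylOp X f ξ = weylPhase X ξ * f (ξ - X.2) := by
  simp [weylOp, SchwartzMap.smulLeftCLM_apply_apply (hasTemperateGrowth_weylPhase X)]

theorem weyl_eq_weylOp (X : Phase ℝ n) (f : 𝓢(Fin n → ℝ, ℂ)) : weyl X f = weylOp X f := by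
  funext ξ
  rw [weylOp_apply]
  rfl

theorem norm_weylOp_apply (X : Phase ℝ n) (f : 𝓢(Fin n → ℝ, ℂ)) (ξ : Fin n → ℝ) :
    ‖weylOp X f ξ‖ = ‖f (ξ - X.2)‖ := by
  rw [weylOp_apply, norm_mul, norm_weylPhase, one_mul]

theorem weylOp_zero (f : 𝓢(Fin n → ℝ, ℂ)) : weylOp 0 f = f := by
  ext ξ
  simp [weylOp_apply, weylPhase]

theorem weylOp_weylOp (X X' : Phase ℝ n) (f : 𝓢(Fin n → ℝ, ℂ)) :
    weylOp X (weylOp X' f)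
      = Complex.exp (Complex.I / 2 * ((omega X X' : ℝ) : ℂ)) • weylOp (X + X') f := by
  ext ξ
  simpa only [weyl_eq_weylOp, smul_apply, smul_eq_mul] using weyl_weyl X X' f ξ

theorem weylOp_weylOp_of_omega_eq_zero {X X' : Phase ℝ n} (h : omega X X' = 0)
    (f : 𝓢(Fin n → ℝ, ℂ)) : weylOp X (weylOp X' f) = weylOp (X + X') f := by
  rw [weylOp_weylOp, h, Complex.ofReal_zero, mul_zero, Complex.exp_zero, one_smul]

theorem continuous_weylOp_apply (f : 𝓢(Fin n → ℝ, ℂ)) :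
    Continuous fun p : Phase ℝ n × (Fin n → ℝ) => weylOp p.1 f p.2 := by
  simp only [weylOp_apply, weylPhase]
  fun_prop

/-! ### The operators `Ω(Y)` -/

theorem Omega_add (Y Z : Phase ℂ n) : Omega (Y + Z) = Omega Y + Omega Z := by
  simp only [Omega, Prod.fst_add, Prod.snd_add, Pi.add_apply, ← Finset.sum_add_distrib]
  refine Finset.sum_congr rfl fun j _ => ?_
  rw [add_smul, add_mul, add_smul]
  abel

theorem Omega_smul (c : ℂ) (Y : Phase ℂ n) : Omega (c • Y) = c • Omega Y := by
  simp only [Omega, Prod.smul_fst, Prod.smul_snd, Pi.smul_apply, Finset.smul_sum, smul_sub,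
    smul_smul, smul_eq_mul, mul_assoc]

theorem hasLineDerivAt_weylPhase (X : Phase ℝ n) (ξ v : Fin n → ℝ) :
    HasLineDerivAt ℝ (weylPhase X)
      (weylPhase X ξ * (Complex.I * ((∑ j, X.1 j * v j : ℝ) : ℂ))) ξ v := by
  unfold HasLineDerivAt weylPhase
  have hexponent : HasDerivAt
      (fun t : ℝ => ∑ j, X.1 j * (ξ + t • v) j - (∑ j, X.1 j * X.2 j) / 2)
      (∑ j, X.1 j * v j) 0 := by
    refine (HasDerivAt.fun_sum fun j _ => ?_).sub_const _
    simpa using (((hasDerivAt_id (0 : ℝ)).mul_const (v j)).const_add (ξ j)).const_mul (X.1 j)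
  simpa using (hexponent.ofReal_comp.const_mul Complex.I).cexp

theorem fderiv_weylOp (X : Phase ℝ n) (f : 𝓢(Fin n → ℝ, ℂ)) (ξ v : Fin n → ℝ) :
    fderiv ℝ (weylOp X f) ξ v = weylPhase X ξ * (fderiv ℝ f (ξ - X.2) v
      + Complex.I * ((∑ j, X.1 j * v j : ℝ) : ℂ) * f (ξ - X.2)) := by
  have htranslate : HasLineDerivAt ℝ (fun ξ => f (ξ - X.2)) (fderiv ℝ f (ξ - X.2) v) ξ v :=
    ((f.hasFDerivAt (ξ - X.2)).comp ξ ((hasFDerivAt_id ξ).sub_const X.2)).hasLineDerivAt v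
  have hproduct : HasDerivAt (fun t : ℝ => weylPhase X (ξ + t • v) * f (ξ + t • v - X.2)) _ 0 :=
    (hasLineDerivAt_weylPhase X ξ v).mul htranslate
  have hline : HasDerivAt (fun t : ℝ => weylPhase X (ξ + t • v) * f (ξ + t • v - X.2))
      (fderiv ℝ (weylOp X f) ξ v) 0 :=
    (((weylOp X f).hasFDerivAt ξ).hasLineDerivAt v).congr_of_eventuallyEq
      (.of_forall fun t => (weylOp_apply X f _).symm)
  rw [hline.unique hproduct, zero_smul, add_zero]
  ring

theorem Omega_weylOp (Y : Phase ℂ n) (X : Phase ℝ n) (f : 𝓢(Fin n → ℝ, ℂ)) :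
    Omega Y (weylOp X f) = weylOp X (Omega Y f) + omega Y X.toComplex • weylOp X f := by
  ext ξ
  simp only [add_apply, smul_apply, smul_eq_mul, Omega_apply, weylOp_apply,
    fderiv_weylOp, omega, Phase.toComplex, Finset.mul_sum, Finset.sum_mul]
  rw [← Finset.sum_add_distrib]
  refine Finset.sum_congr rfl fun j _ => ?_
  have hsingle : ∑ i, X.1 i * (Pi.single j (1 : ℝ) : Fin n → ℝ) i = X.1 j := by
    simp [Pi.single_apply]
  have hI := Complex.I_ne_zero
  rw [hsingle, Pi.sub_apply, Complex.ofReal_sub]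
  field_simp
  ring

/-! ### Derivatives along the one-parameter groups -/

theorem hasDerivAt_weylOp_smul (Z : Phase ℝ n) (g : 𝓢(Fin n → ℝ, ℂ)) (ξ : Fin n → ℝ) (t : ℝ) :
    HasDerivAt (fun s : ℝ => weylOp (s • Z) g ξ)
      (weylOp (t • Z) (Complex.I • Omega Z.toComplex g) ξ) t := by
  have hzero := weyl_hasDerivAt Z g (ξ - (t • Z).2)
  rw [← sub_self t] at hzero
  have hshift := (hzero.comp_sub_const t t).const_mul (weylPhase (t • Z) ξ)
  rw [weylOp_apply, smul_apply, smul_eq_mul]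
  refine hshift.congr_of_eventuallyEq (.of_forall fun s => ?_)
  have hcomm : omega (t • Z) ((s - t) • Z) = 0 := by
    rw [omega_smul_left, omega_smul_right, omega_self, mul_zero, mul_zero]
  dsimp only
  rw [weyl_eq_weylOp, ← weylOp_apply, weylOp_weylOp_of_omega_eq_zero hcomm, ← add_smul,
    add_sub_cancel]

/-! ### The `L²` pairing -/

/-- Complex conjugation on Schwartz functions. -/
def conjSchwartz (f : 𝓢(Fin n → ℝ, ℂ)) : 𝓢(Fin n → ℝ, ℂ) :=
  SchwartzMap.postcompCLM (𝕜 := ℝ) Complex.conjCLE.toContinuousLinearMap f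

/-- The Schwartz function `ξ ↦ f̄(ξ) g(ξ)`. -/
def conjMul (f g : 𝓢(Fin n → ℝ, ℂ)) : 𝓢(Fin n → ℝ, ℂ) :=
  SchwartzMap.pairing (ContinuousLinearMap.mul ℝ ℂ) (conjSchwartz f) g

theorem conjMul_apply (f g : 𝓢(Fin n → ℝ, ℂ)) (ξ : Fin n → ℝ) :
    conjMul f g ξ = conj (f ξ) * g ξ := rfl

theorem integrable_conj_mul (f g : 𝓢(Fin n → ℝ, ℂ)) :
    Integrable fun ξ => conj (f ξ) * g ξ :=
  (conjMul f g).integrable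

theorem l2Inner_add_right (f g h : 𝓢(Fin n → ℝ, ℂ)) :
    l2Inner f (g + h : 𝓢(Fin n → ℝ, ℂ)) = l2Inner f g + l2Inner f h := by
  simp only [l2Inner, add_apply, mul_add]
  exact integral_add (integrable_conj_mul f g) (integrable_conj_mul f h)

theorem l2Inner_smul_right (c : ℂ) (f g : 𝓢(Fin n → ℝ, ℂ)) :
    l2Inner f (c • g : 𝓢(Fin n → ℝ, ℂ)) = c * l2Inner f g := by
  simp only [l2Inner, smul_apply, smul_eq_mul, mul_left_comm, integral_const_mul]

theorem l2Inner_conj_symm (f g : (Fin n → ℝ) → ℂ) : conj (l2Inner g f) = l2Inner f g := by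
  simp only [l2Inner, ← integral_conj, map_mul, Complex.conj_conj, mul_comm]

/-- The `L²` pairing as a linear function of the second argument. -/
def l2InnerHom (f : 𝓢(Fin n → ℝ, ℂ)) : 𝓢(Fin n → ℝ, ℂ) →ₗ[ℂ] ℂ where
  toFun g := l2Inner f g
  map_add' := l2Inner_add_right f
  map_smul' c g := l2Inner_smul_right c f g

theorem conj_weylPhase (X : Phase ℝ n) (ξ : Fin n → ℝ) :
    conj (weylPhase X ξ) = weylPhase (-X) (ξ - X.2) := by
  simp only [weylPhase, ← Complex.exp_conj, map_mul, Complex.conj_I, Complex.conj_ofReal,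
    neg_mul, ← mul_neg, ← Complex.ofReal_neg]
  congr 3
  simp only [Prod.fst_neg, Prod.snd_neg, Pi.neg_apply, Pi.sub_apply, mul_sub, neg_mul, mul_neg,
    neg_neg, Finset.sum_sub_distrib, Finset.sum_neg_distrib]
  ring

theorem l2Inner_weylOp_left (X : Phase ℝ n) (f g : 𝓢(Fin n → ℝ, ℂ)) :
    l2Inner (weylOp X f) g = l2Inner f (weylOp (-X) g) := by
  simp only [l2Inner]
  rw [← integral_sub_right_eq_self (fun ξ => conj (f ξ) * weylOp (-X) g ξ) X.2]
  refine integral_congr_ae (.of_forall fun ξ => ?_)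
  simp only [weylOp_apply, map_mul, conj_weylPhase, Prod.snd_neg, sub_neg_eq_add, sub_add_cancel]
  ring

theorem l2Inner_weylOp_weylOp (X X' : Phase ℝ n) (f g : 𝓢(Fin n → ℝ, ℂ)) :
    l2Inner (weylOp X f) (weylOp X' g)
      = Complex.exp (Complex.I / 2 * ((-omega X X' : ℝ) : ℂ)) * l2Inner f (weylOp (X' - X) g) := by
  rw [l2Inner_weylOp_left, weylOp_weylOp, l2Inner_smul_right, omega_neg_left, neg_add_eq_sub]

theorem norm_l2Inner_weylOp_weylOp (X X' : Phase ℝ n) (f g : 𝓢(Fin n → ℝ, ℂ)) :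
    ‖l2Inner (weylOp X f) (weylOp X' g)‖ = ‖l2Inner f (weylOp (X' - X) g)‖ := by
  rw [l2Inner_weylOp_weylOp, norm_mul, Complex.norm_exp]
  simp

theorem l2Inner_coordOp (j : Fin n) (f g : 𝓢(Fin n → ℝ, ℂ)) :
    l2Inner (coordOp j f) g = l2Inner f (coordOp j g) := by
  simp only [l2Inner, coordOp, SchwartzMap.smulLeftCLM_apply_apply (coord_temperate j),
    smul_eq_mul, map_mul, Complex.conj_ofReal, mul_left_comm, mul_assoc]

theorem partialOp_conjSchwartz (j : Fin n) (f : 𝓢(Fin n → ℝ, ℂ)) :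
    partialOp j (conjSchwartz f) = conjSchwartz (partialOp j f) := by
  ext ξ
  have hconj : HasFDerivAt (conjSchwartz f)
      (Complex.conjCLE.toContinuousLinearMap.comp (fderiv ℝ f ξ)) ξ :=
    Complex.conjCLE.toContinuousLinearMap.hasFDerivAt.comp ξ (f.hasFDerivAt ξ)
  change fderiv ℝ (conjSchwartz f) ξ (Pi.single j 1) = conj (fderiv ℝ f ξ (Pi.single j 1))
  rw [hconj.fderiv]
  rfl

theorem l2Inner_partialOp (j : Fin n) (f g : 𝓢(Fin n → ℝ, ℂ)) :
    l2Inner (partialOp j f) g = -l2Inner f (partialOp j g) := by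
  have hparts : ∫ ξ, conjSchwartz f ξ * partialOp j g ξ
      = -∫ ξ, partialOp j (conjSchwartz f) ξ * g ξ :=
    SchwartzMap.integral_mul_lineDerivOp_right_eq_neg_left (conjSchwartz f) g (Pi.single j 1)
  rw [partialOp_conjSchwartz] at hparts
  exact (neg_eq_iff_eq_neg.2 hparts).symm

theorem l2Inner_Omega_left (Y : Phase ℂ n) (f g : 𝓢(Fin n → ℝ, ℂ)) :
    l2Inner (Omega Y f) g = l2Inner f (Omega Y.conj g) := by
  rw [← l2Inner_conj_symm]
  change conj (l2InnerHom g (Omega Y f)) = l2InnerHom f (Omega Y.conj g)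
  simp only [Omega, _root_.sum_apply, map_sum, _root_.sub_apply, _root_.smul_apply,
    map_sub, map_smul, smul_eq_mul, map_mul]
  refine Finset.sum_congr rfl fun j _ => ?_
  simp only [l2InnerHom, LinearMap.coe_mk, AddHom.coe_mk, l2Inner_conj_symm, l2Inner_coordOp,
    l2Inner_partialOp, Phase.conj]
  simp

theorem hasDerivAt_l2Inner_weylOp_smul (Z : Phase ℝ n) (g f : 𝓢(Fin n → ℝ, ℂ)) (t : ℝ) :
    HasDerivAt (fun s : ℝ => l2Inner (weylOp (s • Z) g) f)
      (l2Inner (weylOp (t • Z) (Complex.I • Omega Z.toComplex g)) f) t := by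
  set g' := Complex.I • Omega Z.toComplex g
  refine (hasDerivAt_integral_of_dominated_loc_of_deriv_le (s := Set.univ)
    (F := fun (s : ℝ) ξ => conj (weylOp (s • Z) g ξ) * f ξ)
    (F' := fun (s : ℝ) ξ => conj (weylOp (s • Z) g' ξ) * f ξ)
    (bound := fun ξ => SchwartzMap.seminorm ℝ 0 0 g' * ‖f ξ‖) Filter.univ_mem
    (.of_forall fun s => (integrable_conj_mul _ f).aestronglyMeasurable)
    (integrable_conj_mul _ f) (integrable_conj_mul _ f).aestronglyMeasurable
    (.of_forall fun ξ s _ => ?_) (f.integrable.norm.const_mul _)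
    (.of_forall fun ξ s _ => ((hasDerivAt_weylOp_smul Z g ξ s).star).mul_const _)).2
  rw [norm_mul, RCLike.norm_conj, norm_weylOp_apply]
  exact mul_le_mul_of_nonneg_right (norm_le_seminorm ℝ g' _) (norm_nonneg _)

/-! ### Decay of matrix coefficients -/

theorem norm_conj_mul_weylOp_le (f g : 𝓢(Fin n → ℝ, ℂ)) (X : Phase ℝ n) (ξ : Fin n → ℝ) :
    ‖conj (f ξ) * weylOp X g ξ‖ ≤ ‖f ξ‖ * SchwartzMap.seminorm ℝ 0 0 g := by
  rw [norm_mul, norm_weylOp_apply, RCLike.norm_conj]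
  exact mul_le_mul_of_nonneg_left (norm_le_seminorm ℝ g _) (norm_nonneg _)

theorem continuous_l2Inner_weylOp (f g : 𝓢(Fin n → ℝ, ℂ)) :
    Continuous fun X : Phase ℝ n => l2Inner f (weylOp X g) :=
  continuous_of_dominated (fun X => (integrable_conj_mul f (weylOp X g)).aestronglyMeasurable)
    (fun X => .of_forall (norm_conj_mul_weylOp_le f g X)) (f.integrable.norm.mul_const _)
    (.of_forall fun _ =>
      ((continuous_weylOp_apply g).comp₂ continuous_id continuous_const).const_mul _)

theorem continuous_l2Inner_weylOp_weylOp (f g : 𝓢(Fin n → ℝ, ℂ)) :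
    Continuous fun p : Phase ℝ n × Phase ℝ n => l2Inner (weylOp p.1 f) (weylOp p.2 g) := by
  have hdiff := (continuous_l2Inner_weylOp f g).comp
    (continuous_snd.sub continuous_fst : Continuous fun p : Phase ℝ n × Phase ℝ n => p.2 - p.1)
  simp only [l2Inner_weylOp_weylOp]
  refine Continuous.mul ?_ hdiff
  unfold omega
  fun_prop

theorem omega_mul_l2Inner_weylOp (Y : Phase ℂ n) (X : Phase ℝ n) (f g : 𝓢(Fin n → ℝ, ℂ)) :
    omega Y X.toComplex * l2Inner f (weylOp X g)
      = l2Inner (Omega Y.conj f) (weylOp X g) - l2Inner f (weylOp X (Omega Y g)) := by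
  rw [l2Inner_Omega_left, Phase.conj_conj, Omega_weylOp, l2Inner_add_right, l2Inner_smul_right,
    add_sub_cancel_left]

theorem norm_le_sum_norm_omega (X : Phase ℝ n) :
    ‖X‖ ≤ ∑ j, (‖omega (0, Pi.single j 1) X.toComplex‖
      + ‖omega (Pi.single j 1, 0) X.toComplex‖) := by
  have hcoord (j : Fin n) : ‖omega (0, Pi.single j 1) X.toComplex‖
      + ‖omega (Pi.single j 1, 0) X.toComplex‖ = ‖X.1 j‖ + ‖X.2 j‖ := by
    simp [omega, Phase.toComplex, Pi.single_apply]
  have hnonneg : ∀ j ∈ Finset.univ, 0 ≤ ‖X.1 j‖ + ‖X.2 j‖ := fun j _ => by positivity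
  have hle (j : Fin n) : ‖X.1 j‖ + ‖X.2 j‖ ≤ ∑ j, (‖X.1 j‖ + ‖X.2 j‖) :=
    Finset.single_le_sum hnonneg (Finset.mem_univ j)
  simp only [hcoord]
  refine norm_prod_le_iff.2 ⟨?_, ?_⟩ <;>
    refine (pi_norm_le_iff_of_nonneg (Finset.sum_nonneg hnonneg)).2 fun j => le_trans ?_ (hle j)
  · exact le_add_of_nonneg_right (norm_nonneg _)
  · exact le_add_of_nonneg_left (norm_nonneg _)

theorem exists_pow_mul_norm_l2Inner_weylOp_le (N : ℕ) (f g : 𝓢(Fin n → ℝ, ℂ)) :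
    ∃ C, ∀ X, (1 + ‖X‖) ^ N * ‖l2Inner f (weylOp X g)‖ ≤ C := by
  induction N generalizing f g with
  | zero =>
    refine ⟨∫ ξ, ‖f ξ‖ * SchwartzMap.seminorm ℝ 0 0 g, fun X => ?_⟩
    rw [pow_zero, one_mul]
    exact norm_integral_le_of_norm_le (f.integrable.norm.mul_const _)
      (.of_forall (norm_conj_mul_weylOp_le f g X))
  | succ N ih =>
    have homega (Y : Phase ℂ n) : ∃ C, ∀ X,
        (1 + ‖X‖) ^ N * ‖l2Inner f (weylOp X g)‖ * ‖omega Y X.toComplex‖ ≤ C := by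
      obtain ⟨C₁, hC₁⟩ := ih (Omega Y.conj f) g
      obtain ⟨C₂, hC₂⟩ := ih f (Omega Y g)
      refine ⟨C₁ + C₂, fun X => le_trans ?_ (add_le_add (hC₁ X) (hC₂ X))⟩
      rw [mul_assoc, mul_comm ‖l2Inner f _‖, ← norm_mul, omega_mul_l2Inner_weylOp, ← mul_add]
      gcongr
      exact norm_sub_le _ _
    choose C hC using homega
    obtain ⟨C₀, hC₀⟩ := ih f g
    refine ⟨C₀ + ∑ j, (C (0, Pi.single j 1) + C (Pi.single j 1, 0)), fun X => ?_⟩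
    set a := (1 + ‖X‖) ^ N * ‖l2Inner f (weylOp X g)‖
    calc (1 + ‖X‖) ^ (N + 1) * ‖l2Inner f (weylOp X g)‖ = a + a * ‖X‖ := by ring
      _ ≤ a + a * ∑ j, (‖omega (0, Pi.single j 1) X.toComplex‖
            + ‖omega (Pi.single j 1, 0) X.toComplex‖) := by
          gcongr
          exact norm_le_sum_norm_omega X
      _ ≤ _ := by
          simp only [Finset.mul_sum, mul_add]
          exact add_le_add (hC₀ X) (Finset.sum_le_sum fun j _ => add_le_add (hC _ X) (hC _ X))

theorem exists_norm_l2Inner_weylOp_le_inv_pow (N : ℕ) (f g : 𝓢(Fin n → ℝ, ℂ)) :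
    ∃ C, 0 ≤ C ∧ ∀ X, ‖l2Inner f (weylOp X g)‖ ≤ C * ((1 + ‖X‖) ^ N)⁻¹ := by
  obtain ⟨C, hC⟩ := exists_pow_mul_norm_l2Inner_weylOp_le N f g
  refine ⟨C, le_trans (by positivity) (hC 0), fun X => ?_⟩
  rw [← div_eq_mul_inv, le_div_iff₀ (by positivity), mul_comm]
  exact hC X

section Integrability

variable {V : Type*}

theorem inv_one_add_norm_sub_pow_le [SeminormedAddCommGroup V] (N : ℕ) (X Z : V) :
    ((1 + ‖X - Z‖) ^ N)⁻¹ ≤ (1 + ‖Z‖) ^ N * ((1 + ‖X‖) ^ N)⁻¹ := by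
  have hmul : 1 + ‖X‖ ≤ (1 + ‖Z‖) * (1 + ‖X - Z‖) := by
    nlinarith [norm_le_norm_sub_add X Z, mul_nonneg (norm_nonneg (X - Z)) (norm_nonneg Z)]
  rw [← div_eq_mul_inv, inv_eq_one_div, div_le_div_iff₀ (by positivity) (by positivity), one_mul,
    ← mul_pow]
  gcongr

theorem integrable_inv_one_add_norm_pow [NormedAddCommGroup V] [NormedSpace ℝ V]
    [FiniteDimensional ℝ V] [MeasurableSpace V] [BorelSpace V] (μ : Measure V)
    [μ.IsAddHaarMeasure] {N : ℕ} (hN : Module.finrank ℝ V < N) :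
    Integrable (fun x : V => ((1 + ‖x‖) ^ N)⁻¹) μ := by
  refine (integrable_one_add_norm (μ := μ) (r := N) (by exact_mod_cast hN)).congr
    (.of_forall fun x => ?_)
  dsimp only
  rw [Real.rpow_neg (by positivity), Real.rpow_natCast]

end Integrability

theorem finrank_phase : Module.finrank ℝ (Phase ℝ n) = n + n := by
  simp

theorem finrank_submodule_lt (L : Submodule ℝ (Phase ℝ n)) :
    Module.finrank ℝ L < n + n + 1 :=
  Nat.lt_succ_of_le (finrank_phase (n := n) ▸ Submodule.finrank_le L)

theorem exists_norm_l2Inner_weylOp_weylOp_le (N : ℕ) (f g : 𝓢(Fin n → ℝ, ℂ)) :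
    ∃ C, 0 ≤ C ∧ ∀ Z X : Phase ℝ n, ‖l2Inner (weylOp Z f) (weylOp X g)‖
      ≤ C * ((1 + ‖Z‖) ^ N * ((1 + ‖X‖) ^ N)⁻¹) := by
  obtain ⟨C, hC₀, hC⟩ := exists_norm_l2Inner_weylOp_le_inv_pow N f g
  refine ⟨C, hC₀, fun Z X => ?_⟩
  rw [norm_l2Inner_weylOp_weylOp]
  exact (hC _).trans (mul_le_mul_of_nonneg_left (inv_one_add_norm_sub_pow_le N X Z) hC₀)

/-! ### The inner product of the constrained system -/

section PhysInner

variable {L : Submodule ℝ (Phase ℝ n)} {μ : Measure L}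

theorem physInner_eq (f g : 𝓢(Fin n → ℝ, ℂ)) :
    physInner L μ f g = ∫ X : L, l2Inner f (weylOp X g) ∂μ := by
  simp only [physInner, weyl_eq_weylOp]

theorem physInner_smul_right (c : ℂ) (f g : 𝓢(Fin n → ℝ, ℂ)) :
    physInner L μ f (c • g) = c * physInner L μ f g := by
  simp only [physInner_eq, map_smul, l2Inner_smul_right, integral_const_mul]

theorem physInner_Omega_left {Y : Phase ℂ n} (hY : Y ∈ skewComplement L)
    (f g : 𝓢(Fin n → ℝ, ℂ)) :
    physInner L μ (Omega Y f) g = physInner L μ f (Omega Y.conj g) := by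
  rw [physInner_eq, physInner_eq]
  refine integral_congr_ae (.of_forall fun X => ?_)
  simp only [l2Inner_Omega_left, Omega_weylOp, conj_mem_skewComplement hY X X.2, zero_smul,
    add_zero]

variable [μ.IsAddHaarMeasure]

theorem integrable_l2Inner_weylOp (f g : 𝓢(Fin n → ℝ, ℂ)) :
    Integrable (fun X : L => l2Inner f (weylOp X g)) μ := by
  obtain ⟨C, -, hC⟩ := exists_norm_l2Inner_weylOp_le_inv_pow (n + n + 1) f g
  exact ((integrable_inv_one_add_norm_pow μ (finrank_submodule_lt L)).const_mul C).mono'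
    ((continuous_l2Inner_weylOp f g).comp continuous_subtype_val).aestronglyMeasurable
    (.of_forall fun X => hC X)

theorem physInner_add_right (f g h : 𝓢(Fin n → ℝ, ℂ)) :
    physInner L μ f (g + h) = physInner L μ f g + physInner L μ f h := by
  simp only [physInner_eq, map_add, l2Inner_add_right]
  exact integral_add (integrable_l2Inner_weylOp f g) (integrable_l2Inner_weylOp f h)

theorem physInner_conj_symm (f g : 𝓢(Fin n → ℝ, ℂ)) :
    conj (physInner L μ g f) = physInner L μ f g := by
  have : ProperSpace L := FiniteDimensional.proper_real L
  rw [physInner_eq, physInner_eq, ← integral_conj, ← integral_neg_eq_self]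
  refine integral_congr_ae (.of_forall fun X => ?_)
  dsimp only
  rw [l2Inner_conj_symm, l2Inner_weylOp_left, Submodule.coe_neg, neg_neg]

theorem physInner_add_left (f g h : 𝓢(Fin n → ℝ, ℂ)) :
    physInner L μ (f + g) h = physInner L μ f h + physInner L μ g h := by
  rw [← physInner_conj_symm, physInner_add_right, map_add, physInner_conj_symm,
    physInner_conj_symm]

theorem physInner_smul_left (c : ℂ) (f g : 𝓢(Fin n → ℝ, ℂ)) :
    physInner L μ (c • f) g = conj c * physInner L μ f g := by
  rw [← physInner_conj_symm, physInner_smul_right, map_mul, physInner_conj_symm]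

theorem physInner_weylOp_left (hL : IsIsotropic L) {Z : Phase ℝ n} (hZ : Z ∈ L)
    (f g : 𝓢(Fin n → ℝ, ℂ)) : physInner L μ (weylOp Z f) g = physInner L μ f g := by
  rw [← physInner_conj_symm, ← physInner_conj_symm f, physInner_eq, physInner_eq,
    ← integral_add_right_eq_self (fun X : L => l2Inner g (weylOp X f)) ⟨Z, hZ⟩]
  simp only [weylOp_weylOp_of_omega_eq_zero (hL _ (Subtype.prop _) Z hZ), Submodule.coe_add]

theorem hasDerivAt_physInner_weylOp_smul (Z : Phase ℝ n) (g f : 𝓢(Fin n → ℝ, ℂ)) (t : ℝ) :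
    HasDerivAt (fun s : ℝ => physInner L μ (weylOp (s • Z) g) f)
      (physInner L μ (weylOp (t • Z) (Complex.I • Omega Z.toComplex g)) f) t := by
  obtain ⟨g', hg'⟩ : ∃ g', g' = Complex.I • Omega Z.toComplex g := ⟨_, rfl⟩
  rw [← hg']
  obtain ⟨C, hC₀, hC⟩ := exists_norm_l2Inner_weylOp_weylOp_le (n + n + 1) g' f
  have hbound (X : L) (s : ℝ) (hs : s ∈ Metric.ball t 1) :
      ‖l2Inner (weylOp (s • Z) g') (weylOp (X : Phase ℝ n) f)‖
        ≤ C * ((1 + (|t| + 1) * ‖Z‖) ^ (n + n + 1) * ((1 + ‖X‖) ^ (n + n + 1))⁻¹) := by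
    have hst : |s| ≤ |t| + 1 := by
      have hdist : |s - t| < 1 := by simpa [Real.dist_eq] using hs
      linarith [abs_sub_abs_le_abs_sub s t]
    refine (hC _ _).trans (mul_le_mul_of_nonneg_left ?_ hC₀)
    rw [norm_smul, Real.norm_eq_abs, Submodule.coe_norm]
    gcongr
  have hderiv (X : L) (s : ℝ) (_ : s ∈ Metric.ball t 1) :
      HasDerivAt (fun r : ℝ => l2Inner (weylOp (r • Z) g) (weylOp (X : Phase ℝ n) f))
        (l2Inner (weylOp (s • Z) g') (weylOp (X : Phase ℝ n) f)) s := by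
    rw [hg']
    exact hasDerivAt_l2Inner_weylOp_smul Z g (weylOp (X : Phase ℝ n) f) s
  have hint := ((integrable_inv_one_add_norm_pow μ (finrank_submodule_lt L)).const_mul
    ((1 + (|t| + 1) * ‖Z‖) ^ (n + n + 1))).const_mul C
  simp only [physInner_eq]
  exact (hasDerivAt_integral_of_dominated_loc_of_deriv_le (Metric.ball_mem_nhds t one_pos)
    (.of_forall fun s => (integrable_l2Inner_weylOp (weylOp (s • Z) g) f).aestronglyMeasurable)
    (integrable_l2Inner_weylOp (weylOp (t • Z) g) f)
    (integrable_l2Inner_weylOp (weylOp (t • Z) g') f).aestronglyMeasurable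
    (.of_forall hbound) hint (.of_forall hderiv)).2

end PhysInner

/-! ### Positivity of the inner product -/

section PositiveDefinite

open Filter Topology Metric

variable {V : Type*} [NormedAddCommGroup V] [MeasurableSpace V] [BorelSpace V]

theorem setIntegral_setIntegral_sub [SecondCountableTopology V] (μ : Measure V)
    [SFinite μ] [μ.IsAddRightInvariant] {F : V → ℂ} (hF : Integrable F μ) {s : Set V}
    (hs : MeasurableSet s) (hμs : μ s ≠ ⊤) :
    ∫ x in s, ∫ y in s, F (y - x) ∂μ ∂μ = ∫ z, μ.real (s ∩ (z + ·) ⁻¹' s) • F z ∂μ := by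
  have : IsFiniteMeasure (μ.restrict s) := ⟨by simpa using hμs.lt_top⟩
  have hmeas : MeasurableSet {p : V × V | p.2 + p.1 ∈ s} :=
    (measurable_snd.add measurable_fst) hs
  have hint : Integrable (fun p : V × V => {p | p.2 + p.1 ∈ s}.indicator (fun p => F p.2) p)
      ((μ.restrict s).prod μ) := (hF.comp_snd (μ.restrict s)).indicator hmeas
  calc ∫ x in s, ∫ y in s, F (y - x) ∂μ ∂μ
      = ∫ x in s, ∫ z, {p : V × V | p.2 + p.1 ∈ s}.indicator (fun p => F p.2) (x, z) ∂μ ∂μ := by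
        refine integral_congr_ae (.of_forall fun x => ?_)
        dsimp only
        rw [← integral_indicator hs, ← integral_add_right_eq_self _ x]
        simp only [Set.indicator, add_sub_cancel_right, Set.mem_ofPred_eq]
    _ = ∫ z, ∫ x in s, {p : V × V | p.2 + p.1 ∈ s}.indicator (fun p => F p.2) (x, z) ∂μ ∂μ :=
        integral_integral_swap hint
    _ = ∫ z, μ.real (s ∩ (z + ·) ⁻¹' s) • F z ∂μ := by
        refine integral_congr_ae (.of_forall fun z => ?_)
        have hz : MeasurableSet ((z + ·) ⁻¹' s) := (measurable_const_add z) hs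
        calc ∫ x in s, {p : V × V | p.2 + p.1 ∈ s}.indicator (fun p => F p.2) (x, z) ∂μ
            = ∫ x in s, ((z + ·) ⁻¹' s).indicator (fun _ => F z) x ∂μ := rfl
          _ = μ.real (s ∩ (z + ·) ⁻¹' s) • F z := by
            rw [setIntegral_indicator hz, setIntegral_const]

variable [NormedSpace ℝ V] [FiniteDimensional ℝ V] (μ : Measure V) [μ.IsAddHaarMeasure]

theorem tendsto_measureReal_closedBall_inter_div (z : V) :
    Tendsto (fun R : ℝ => μ.real (closedBall 0 R ∩ (z + ·) ⁻¹' closedBall 0 R) /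
      μ.real (closedBall (0 : V) R)) atTop (𝓝 1) := by
  have : ProperSpace V := FiniteDimensional.proper_real V
  have hlower : Tendsto (fun R : ℝ => (1 - ‖z‖ / R) ^ Module.finrank ℝ V) atTop (𝓝 1) := by
    simpa using ((tendsto_const_nhds (x := ‖z‖)).div_atTop tendsto_id).const_sub 1 |>.pow
      (Module.finrank ℝ V)
  have hsub (R : ℝ) :
      closedBall (0 : V) (R - ‖z‖) ⊆ closedBall 0 R ∩ (z + ·) ⁻¹' closedBall 0 R := fun x hx => by
    have hx' : ‖x‖ ≤ R - ‖z‖ := by simpa using hx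
    have := norm_add_le z x
    simp only [Set.mem_inter_iff, Set.mem_preimage, mem_closedBall_zero_iff]
    constructor <;> linarith [norm_nonneg z]
  have hunit : 0 < μ.real (ball (0 : V) 1) :=
    ENNReal.toReal_pos (measure_ball_pos μ 0 one_pos).ne' measure_ball_lt_top.ne
  refine tendsto_of_tendsto_of_tendsto_of_le_of_le' hlower tendsto_const_nhds ?_
    (.of_forall fun R => div_le_one_of_le₀ (measureReal_mono Set.inter_subset_left
      measure_closedBall_lt_top.ne) measureReal_nonneg)
  filter_upwards [eventually_gt_atTop ‖z‖] with R hR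
  have hR₀ : 0 < R := (norm_nonneg z).trans_lt hR
  rw [Measure.addHaar_real_closedBall μ 0 hR₀.le, le_div_iff₀ (by positivity)]
  calc (1 - ‖z‖ / R) ^ Module.finrank ℝ V * (R ^ Module.finrank ℝ V * μ.real (ball 0 1))
      = (R - ‖z‖) ^ Module.finrank ℝ V * μ.real (ball 0 1) := by
        rw [← mul_assoc, ← mul_pow, sub_mul, one_mul, div_mul_cancel₀ _ hR₀.ne']
    _ = μ.real (closedBall (0 : V) (R - ‖z‖)) :=
        (Measure.addHaar_real_closedBall μ 0 (sub_nonneg.2 hR.le)).symm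
    _ ≤ _ := measureReal_mono (hsub R)
        (measure_ne_top_of_subset Set.inter_subset_left measure_closedBall_lt_top.ne)

theorem tendsto_setIntegral_setIntegral_sub_div {F : V → ℂ} (hF : Integrable F μ) :
    Tendsto (fun R : ℝ => (μ.real (closedBall (0 : V) R))⁻¹ •
      ∫ x in closedBall 0 R, ∫ y in closedBall 0 R, F (y - x) ∂μ ∂μ) atTop (𝓝 (∫ z, F z ∂μ)) := by
  have : ProperSpace V := FiniteDimensional.proper_real V
  simp only [setIntegral_setIntegral_sub μ hF measurableSet_closedBall
    measure_closedBall_lt_top.ne, ← integral_smul, smul_smul, ← div_eq_inv_mul]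
  have hmeas (R : ℝ) : Measurable fun z : V =>
      μ.real (closedBall 0 R ∩ (z + ·) ⁻¹' closedBall 0 R) :=
    (measurable_measure_prodMk_left ((measurable_snd measurableSet_closedBall).inter
      (measurable_add measurableSet_closedBall))).ennreal_toReal
  refine tendsto_integral_filter_of_dominated_convergence (fun z => ‖F z‖)
    (.of_forall fun R => ((hmeas R).div_const _).aestronglyMeasurable.smul hF.aestronglyMeasurable)
    (.of_forall fun R => .of_forall fun z => ?_) hF.norm (.of_forall fun z => ?_)
  · rw [norm_smul, Real.norm_of_nonneg (by positivity)]
    exact mul_le_of_le_one_left (norm_nonneg _) (div_le_one_of_le₀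
      (measureReal_mono Set.inter_subset_left measure_closedBall_lt_top.ne) measureReal_nonneg)
  · simpa using (tendsto_measureReal_closedBall_inter_div μ z).smul_const (F z)

/-- A function `F` is positive definite when `F (y - x) = ⟪u x, u y⟫`; averaging this identity over
large balls shows that its integral is nonnegative. -/
theorem re_integral_nonneg_of_inner_eq_sub {H : Type*} [NormedAddCommGroup H]
    [InnerProductSpace ℂ H] [CompleteSpace H] {F : V → ℂ} (hF : Integrable F μ)
    (hF_cont : Continuous F) {u : V → H} (hu : ∀ x y, inner ℂ (u x) (u y) = F (y - x)) :
    0 ≤ (∫ z, F z ∂μ).re := by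
  have : ProperSpace V := FiniteDimensional.proper_real V
  have hu_dist (x y : V) : dist (u x) (u y) = √(2 * (F 0 - F (y - x)).re) := by
    rw [dist_eq_norm, ← Real.sqrt_sq (norm_nonneg _), @norm_sub_sq ℂ, hu, ← inner_self_eq_norm_sq
      (𝕜 := ℂ) (u x), ← inner_self_eq_norm_sq (𝕜 := ℂ) (u y), hu, hu, sub_self, sub_self,
      Complex.sub_re]
    congr 1
    simp only [RCLike.re_to_complex]
    ring
  have hu_cont : Continuous u := continuous_iff_continuousAt.2 fun x => by
    have hlim : Tendsto (fun y => √(2 * (F 0 - F (x - y)).re)) (𝓝 x)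
        (𝓝 √(2 * (F 0 - F (x - x)).re)) := Continuous.tendsto (by fun_prop) x
    rw [ContinuousAt, tendsto_iff_dist_tendsto_zero]
    simpa [hu_dist] using hlim
  have hu_int (R : ℝ) : IntegrableOn u (closedBall 0 R) μ :=
    hu_cont.continuousOn.integrableOn_compact (isCompact_closedBall 0 R)
  refine ge_of_tendsto ((Complex.continuous_re.tendsto _).comp
    (tendsto_setIntegral_setIntegral_sub_div μ hF)) (.of_forall fun R => ?_)
  have haverage : ∫ x in closedBall 0 R, ∫ y in closedBall 0 R, F (y - x) ∂μ ∂μ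
      = inner ℂ (∫ x in closedBall 0 R, u x ∂μ) (∫ y in closedBall 0 R, u y ∂μ) := by
    simp only [← hu, integral_inner (hu_int R)]
    rw [← inner_conj_symm, ← integral_inner (hu_int R), ← integral_conj]
    simp only [inner_conj_symm]
  rw [Function.comp_apply, haverage, Complex.smul_re, ← RCLike.re_to_complex]
  exact smul_nonneg (inv_nonneg.2 measureReal_nonneg) inner_self_nonneg

end PositiveDefinite

section PhysInner

variable {L : Submodule ℝ (Phase ℝ n)} {μ : Measure L} [μ.IsAddHaarMeasure]

theorem physInner_self_re_nonneg (hL : IsIsotropic L) (g : 𝓢(Fin n → ℝ, ℂ)) :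
    0 ≤ (physInner L μ g g).re := by
  rw [physInner_eq]
  refine re_integral_nonneg_of_inner_eq_sub μ (integrable_l2Inner_weylOp g g)
    ((continuous_l2Inner_weylOp g g).comp continuous_subtype_val)
    (u := fun X : L => (weylOp (X : Phase ℝ n) g).toLp 2) fun X X' => ?_
  refine (inner_toL2_toL2_eq (weylOp X g) (weylOp X' g)).trans ?_
  simp only [RCLike.inner_apply']
  change l2Inner (weylOp (X : Phase ℝ n) g) (weylOp (X' : Phase ℝ n) g) = _
  rw [l2Inner_weylOp_weylOp, hL X X.2 X' X'.2]
  simp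

end PhysInner

/-! ### Null vectors -/

section NullVectors

variable {L : Submodule ℝ (Phase ℝ n)} {μ : Measure L} [μ.IsAddHaarMeasure]

/-- The inner product of the constrained system as a semi-inner product on Schwartz space, which
gives access to the Cauchy–Schwarz inequality. It is not an instance since it depends on the
choice of `L` and `μ`. -/
abbrev physInnerCore (hL : IsIsotropic L) (μ : Measure L) [μ.IsAddHaarMeasure] :
    PreInnerProductSpace.Core ℂ 𝓢(Fin n → ℝ, ℂ) where
  inner := physInner L μ
  conj_inner_symm := physInner_conj_symm
  re_inner_nonneg := physInner_self_re_nonneg hL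
  add_left := physInner_add_left
  smul_left f g c := physInner_smul_left c f g

theorem IsNull.physInner_right (hL : IsIsotropic L) {f : 𝓢(Fin n → ℝ, ℂ)} (hf : IsNull L μ f)
    (g : 𝓢(Fin n → ℝ, ℂ)) : physInner L μ g f = 0 := by
  have hcs := @InnerProductSpace.Core.inner_mul_inner_self_le ℂ _ _ _ _ (physInnerCore hL μ) g f
  change ‖physInner L μ g f‖ * ‖physInner L μ f g‖
    ≤ (physInner L μ g g).re * (physInner L μ f f).re at hcs
  rw [show physInner L μ f f = 0 from hf, Complex.zero_re, mul_zero, ← physInner_conj_symm f g,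
    RCLike.norm_conj] at hcs
  exact norm_eq_zero.1 (mul_self_eq_zero.1 (le_antisymm hcs (mul_self_nonneg _)))

theorem isNull_iff (hL : IsIsotropic L) {f : 𝓢(Fin n → ℝ, ℂ)} :
    IsNull L μ f ↔ ∀ g, physInner L μ g f = 0 :=
  ⟨fun hf g => hf.physInner_right hL g, fun h => h f⟩

/-- The space of null vectors, by which Schwartz space is divided to obtain the constrained
Hilbert space. -/
def nullSubmodule (hL : IsIsotropic L) (μ : Measure L) [μ.IsAddHaarMeasure] :
    Submodule ℂ 𝓢(Fin n → ℝ, ℂ) where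
  carrier := {f | IsNull L μ f}
  add_mem' {f g} hf hg := (isNull_iff hL).2 fun h => by
    rw [physInner_add_right, hf.physInner_right hL, hg.physInner_right hL, add_zero]
  zero_mem' := (isNull_iff hL).2 fun h => by
    rw [← zero_smul ℂ (0 : 𝓢(Fin n → ℝ, ℂ)), physInner_smul_right, zero_mul]
  smul_mem' c f hf := (isNull_iff hL).2 fun h => by
    rw [physInner_smul_right, hf.physInner_right hL, mul_zero]

theorem mem_nullSubmodule (hL : IsIsotropic L) {f : 𝓢(Fin n → ℝ, ℂ)} :
    f ∈ nullSubmodule hL μ ↔ IsNull L μ f := Iff.rfl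

theorem IsNull.Omega (hL : IsIsotropic L) {Y : Phase ℂ n} (hY : Y ∈ skewComplement L)
    {f : 𝓢(Fin n → ℝ, ℂ)} (hf : IsNull L μ f) : IsNull L μ (Omega Y f) :=
  (isNull_iff hL).2 fun g => by
    rw [← Phase.conj_conj Y, ← physInner_Omega_left (conj_mem_skewComplement hY),
      hf.physInner_right hL]

/-- `⟨e^{isΩ(X)} f, g⟩` does not depend on `s` for `X ∈ L`; differentiate at `s = 0`. -/
theorem isNull_Omega_toComplex (hL : IsIsotropic L) {X : Phase ℝ n} (hX : X ∈ L)
    (f : 𝓢(Fin n → ℝ, ℂ)) : IsNull L μ (Omega X.toComplex f) := by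
  refine (isNull_iff hL).2 fun g => ?_
  have hderiv := hasDerivAt_physInner_weylOp_smul (L := L) (μ := μ) X f g 0
  simp only [physInner_weylOp_left hL (L.smul_mem _ hX)] at hderiv
  have hzero := hderiv.unique (hasDerivAt_const _ _)
  rw [physInner_smul_left, mul_eq_zero, or_iff_right (by simp)] at hzero
  rw [← physInner_conj_symm, hzero, map_zero]

/-- The complexification of `L`, as a subspace of the complexified phase space. -/
def complexSpan (L : Submodule ℝ (Phase ℝ n)) : Submodule ℂ (Phase ℂ n) :=
  Submodule.span ℂ (Phase.toComplex '' (L : Set (Phase ℝ n)))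

theorem isNull_Omega_of_mem_complexSpan (hL : IsIsotropic L) {Y : Phase ℂ n}
    (hY : Y ∈ complexSpan L) (f : 𝓢(Fin n → ℝ, ℂ)) : IsNull L μ (Omega Y f) := by
  rw [← mem_nullSubmodule hL]
  induction hY using Submodule.span_induction with
  | mem Y hY =>
    obtain ⟨X, hX, rfl⟩ := hY
    exact isNull_Omega_toComplex hL hX f
  | zero => simp [Omega]
  | add Y Z _ _ hY hZ => exact Omega_add Y Z ▸ add_mem hY hZ
  | smul c Y _ hY => exact Omega_smul c Y ▸ Submodule.smul_mem _ c hY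

end NullVectors

/-! ### Resolution of the identity by coherent states -/

/-- The Fourier transform `∫ e^{-iP·ξ} u(ξ) dξ` in the angular-frequency convention, which matches
the phases of the operators `e^{iΩ(X)}`. -/
def angularFourier (u : 𝓢(Fin n → ℝ, ℂ)) (P : Fin n → ℝ) : ℂ :=
  ∫ ξ, Complex.exp (-Complex.I * ((∑ j, P j * ξ j : ℝ) : ℂ)) * u ξ

/-- Transfer of a Schwartz function to Euclidean space, where Mathlib's Fourier theory lives. -/
def toEuclidean (u : 𝓢(Fin n → ℝ, ℂ)) : 𝓢(EuclideanSpace ℝ (Fin n), ℂ) :=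
  compCLMOfContinuousLinearEquiv ℂ (EuclideanSpace.equiv (Fin n) ℝ) u

theorem integral_euclideanSpace (F : EuclideanSpace ℝ (Fin n) → ℂ) :
    ∫ w, F w = ∫ ξ : Fin n → ℝ, F (WithLp.toLp 2 ξ) :=
  ((PiLp.volume_preserving_toLp (Fin n)).integral_comp
    (MeasurableEquiv.toLp 2 (Fin n → ℝ)).measurableEmbedding F).symm

theorem fourier_toEuclidean (u : 𝓢(Fin n → ℝ, ℂ)) (P : Fin n → ℝ) :
    FourierTransform.fourier (toEuclidean u) (WithLp.toLp 2 P)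
      = angularFourier u ((2 * Real.pi) • P) := by
  rw [SchwartzMap.fourier_coe, Real.fourier_eq', angularFourier, integral_euclideanSpace]
  refine integral_congr_ae (.of_forall fun ξ => ?_)
  have hphase : ((-2 * Real.pi * inner ℝ (WithLp.toLp 2 ξ) (WithLp.toLp 2 P) : ℝ) : ℂ) * Complex.I
      = -Complex.I * ((∑ j, ((2 * Real.pi) • P) j * ξ j : ℝ) : ℂ) := by
    simp only [PiLp.inner_apply, RCLike.inner_apply', Pi.smul_apply, smul_eq_mul, mul_assoc,
      ← Finset.mul_sum]
    simp only [mul_comm (ξ _), conj_trivial]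
    push_cast
    ring
  exact congrArg (Complex.exp · * u ξ) hphase

theorem integral_conj_angularFourier_mul (u v : 𝓢(Fin n → ℝ, ℂ)) :
    ∫ P, conj (angularFourier u P) * angularFourier v P
      = (2 * Real.pi : ℂ) ^ n * ∫ ξ, conj (u ξ) * v ξ := by
  have hplancherel := SchwartzMap.integral_sesq_fourier_fourier (toEuclidean u) (toEuclidean v)
    (innerSL ℂ)
  simp only [innerSL_apply_apply, RCLike.inner_apply', integral_euclideanSpace,
    fourier_toEuclidean] at hplancherel
  rw [Measure.integral_comp_smul volume
    (fun P : Fin n → ℝ => conj (angularFourier u P) * angularFourier v P), Module.finrank_fin_fun,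
    abs_of_pos (by positivity), Complex.real_smul, Complex.ofReal_inv,
    inv_mul_eq_iff_eq_mul₀ (by simp [Real.pi_ne_zero])] at hplancherel
  exact_mod_cast hplancherel

theorem l2Inner_weylOp_left_eq_angularFourier (Z : Phase ℝ n) (ψ f : 𝓢(Fin n → ℝ, ℂ)) :
    l2Inner (weylOp Z ψ) f = Complex.exp (Complex.I * ((∑ j, Z.1 j * Z.2 j) / 2 : ℝ)) *
      angularFourier (conjMul (SchwartzMap.compSubConstCLM ℂ Z.2 ψ) f) Z.1 := by
  simp only [l2Inner, angularFourier, ← integral_const_mul]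
  refine integral_congr_ae (.of_forall fun ξ => ?_)
  simp only [weylOp_apply, weylPhase, map_mul, ← Complex.exp_conj, Complex.conj_I,
    Complex.conj_ofReal, conjMul_apply, SchwartzMap.compSubConstCLM_apply]
  rw [← mul_assoc, ← mul_assoc, ← Complex.exp_add]
  congr 3
  push_cast
  ring

theorem integral_l2Inner_weylOp_mul_momentum (φ ψ f g : 𝓢(Fin n → ℝ, ℂ)) (Q : Fin n → ℝ) :
    ∫ P, l2Inner g (weylOp (P, Q) ψ) * l2Inner (weylOp (P, Q) φ) f
      = (2 * Real.pi : ℂ) ^ n * ∫ ξ, (conj (φ (ξ - Q)) * ψ (ξ - Q)) * (conj (g ξ) * f ξ) := by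
  have hplancherel := integral_conj_angularFourier_mul
    (conjMul (SchwartzMap.compSubConstCLM ℂ Q ψ) g) (conjMul (SchwartzMap.compSubConstCLM ℂ Q φ) f)
  simp only [conjMul_apply, SchwartzMap.compSubConstCLM_apply, map_mul, Complex.conj_conj]
    at hplancherel
  convert hplancherel using 3 with P
  · rw [← l2Inner_conj_symm, l2Inner_weylOp_left_eq_angularFourier,
      l2Inner_weylOp_left_eq_angularFourier, map_mul, mul_mul_mul_comm, Complex.conj_mul',
      mul_comm Complex.I, Complex.norm_exp_ofReal_mul_I, Complex.ofReal_one, one_pow, one_mul]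
  · funext ξ
    ring

theorem integral_integral_sub_mul {G : Type*} [AddCommGroup G] [MeasurableSpace G]
    [MeasurableAdd₂ G] [MeasurableNeg G] {μ : Measure G} [SFinite μ] [μ.IsAddRightInvariant]
    [μ.IsNegInvariant] {u v : G → ℂ} (hu : Integrable u μ) (hv : Integrable v μ) :
    ∫ x, ∫ y, u (y - x) * v y ∂μ ∂μ = (∫ x, u x ∂μ) * ∫ y, v y ∂μ := by
  have hconv := integral_convolution (ContinuousLinearMap.mul ℝ ℂ) hv hu.comp_neg
  simp only [MeasureTheory.convolution, ContinuousLinearMap.mul_apply', neg_sub,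
    integral_neg_eq_self u] at hconv
  simpa only [mul_comm] using hconv

instance isAddHaarMeasure_volume_phase : (volume : Measure (Phase ℝ n)).IsAddHaarMeasure :=
  Measure.prod.instIsAddHaarMeasure _ _

theorem integrable_l2Inner_weylOp_mul (φ ψ f g : 𝓢(Fin n → ℝ, ℂ)) :
    Integrable fun Z : Phase ℝ n => l2Inner g (weylOp Z ψ) * l2Inner (weylOp Z φ) f := by
  obtain ⟨C, -, hC⟩ := exists_norm_l2Inner_weylOp_le_inv_pow (n + n + 1) g ψ
  obtain ⟨D, -, hD⟩ := exists_norm_l2Inner_weylOp_le_inv_pow 0 f φ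
  have hdecay : Integrable fun Z : Phase ℝ n => l2Inner g (weylOp Z ψ) :=
    ((integrable_inv_one_add_norm_pow volume
      (finrank_phase.trans_lt (Nat.lt_succ_self (n + n)))).const_mul C).mono'
      (continuous_l2Inner_weylOp g ψ).aestronglyMeasurable (.of_forall hC)
  refine hdecay.mul_bdd (c := D) ?_ (.of_forall fun Z => ?_)
  · exact ((Complex.continuous_conj.comp (continuous_l2Inner_weylOp f φ)).congr
      fun Z => l2Inner_conj_symm _ _).aestronglyMeasurable
  · rw [← l2Inner_conj_symm, RCLike.norm_conj]
    simpa using hD Z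

/-- Moyal's identity. -/
theorem integral_l2Inner_weylOp_mul (φ ψ f g : 𝓢(Fin n → ℝ, ℂ)) :
    ∫ Z : Phase ℝ n, l2Inner g (weylOp Z ψ) * l2Inner (weylOp Z φ) f
      = (2 * Real.pi : ℂ) ^ n * l2Inner φ ψ * l2Inner g f := by
  have hint := integrable_l2Inner_weylOp_mul φ ψ f g
  rw [Measure.volume_eq_prod] at hint ⊢
  rw [integral_prod_symm _ hint]
  simp only [integral_l2Inner_weylOp_mul_momentum]
  rw [integral_const_mul, mul_assoc, integral_integral_sub_mul (integrable_conj_mul φ ψ)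
    (integrable_conj_mul g f)]
  rfl

section PhysInner

variable {L : Submodule ℝ (Phase ℝ n)} {μ : Measure L} [μ.IsAddHaarMeasure]

theorem integrable_l2Inner_weylOp_mul_l2Inner_weylOp_weylOp (φ ψ f g : 𝓢(Fin n → ℝ, ℂ)) :
    Integrable (fun p : L × Phase ℝ n => l2Inner g (weylOp p.2 ψ) *
      l2Inner (weylOp p.2 φ) (weylOp (p.1 : Phase ℝ n) f)) (μ.prod volume) := by
  set N := n + n + 1
  obtain ⟨C, hC₀, hC⟩ := exists_norm_l2Inner_weylOp_le_inv_pow (N + N) g ψ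
  obtain ⟨D, -, hD⟩ := exists_norm_l2Inner_weylOp_weylOp_le N φ f
  have hintL := integrable_inv_one_add_norm_pow μ (finrank_submodule_lt L)
  have hintPhase := integrable_inv_one_add_norm_pow (volume : Measure (Phase ℝ n))
    (finrank_phase.trans_lt (Nat.lt_succ_self (n + n)))
  refine ((hintL.const_mul D).mul_prod (hintPhase.const_mul C)).mono' ?_ (.of_forall ?_)
  · exact (((continuous_l2Inner_weylOp g ψ).comp continuous_snd).mul
      ((continuous_l2Inner_weylOp_weylOp φ f).comp (continuous_snd.prodMk
        (continuous_subtype_val.comp continuous_fst)))).aestronglyMeasurable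
  · rintro ⟨X, Z⟩
    calc ‖l2Inner g (weylOp Z ψ) * l2Inner (weylOp Z φ) (weylOp (X : Phase ℝ n) f)‖
        ≤ (C * ((1 + ‖Z‖) ^ (N + N))⁻¹) * (D * ((1 + ‖Z‖) ^ N * ((1 + ‖X‖) ^ N)⁻¹)) := by
          rw [norm_mul]
          exact mul_le_mul (hC Z) (hD Z X) (norm_nonneg _) (by positivity)
      _ = D * ((1 + ‖X‖) ^ N)⁻¹ * (C * ((1 + ‖Z‖) ^ N)⁻¹) := by
          have : (1 + ‖Z‖) ^ N ≠ 0 := by positivity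
          rw [pow_add]
          field_simp

theorem integral_l2Inner_weylOp_mul_physInner (φ ψ f g : 𝓢(Fin n → ℝ, ℂ)) :
    ∫ Z : Phase ℝ n, l2Inner g (weylOp Z ψ) * physInner L μ (weylOp Z φ) f
      = (2 * Real.pi : ℂ) ^ n * l2Inner φ ψ * physInner L μ g f := by
  simp only [physInner_eq, ← integral_const_mul, ← integral_l2Inner_weylOp_mul φ ψ]
  exact (integral_integral_swap
    (integrable_l2Inner_weylOp_mul_l2Inner_weylOp_weylOp φ ψ f g)).symm

theorem isNull_of_physInner_weylOp_eq_zero {ψ f : 𝓢(Fin n → ℝ, ℂ)} (hψ : l2Inner ψ ψ ≠ 0)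
    (hf : ∀ Z : Phase ℝ n, physInner L μ (weylOp Z ψ) f = 0) : IsNull L μ f := by
  have hmoyal := integral_l2Inner_weylOp_mul_physInner (L := L) (μ := μ) ψ ψ f f
  simp only [hf, mul_zero, integral_zero] at hmoyal
  have hpi : (2 * Real.pi : ℂ) ^ n ≠ 0 := by simp [Real.pi_ne_zero]
  exact (mul_eq_zero.1 hmoyal.symm).resolve_left (mul_ne_zero hpi hψ)

end PhysInner

/-! ### Gaussian integrals -/

theorem exists_linearEquiv_sum_mul_sq {V : Type*} [AddCommGroup V] [Module ℝ V]
    [FiniteDimensional ℝ V] {q : QuadraticForm ℝ V} (hq : q.PosDef) :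
    ∃ (w : Fin (Module.finrank ℝ V) → ℝ) (e : V ≃ₗ[ℝ] (Fin (Module.finrank ℝ V) → ℝ)),
      (∀ i, 0 < w i) ∧ ∀ v, q v = ∑ i, w i * e v i ^ 2 := by
  obtain ⟨w, ⟨e⟩⟩ := QuadraticForm.equivalent_weightedSumSquares q
  have hqe : ∀ v, q v = ∑ i, w i * e v i ^ 2 := fun v => by
    simp only [← e.map_app, QuadraticMap.weightedSumSquares_apply, smul_eq_mul, sq]
  refine ⟨w, e.toLinearEquiv, fun i => ?_, hqe⟩
  set v := e.toLinearEquiv.symm (Pi.single i 1)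
  have hev : e v = Pi.single i 1 := e.toLinearEquiv.apply_symm_apply _
  have hpos : 0 < q v := hq v (by simp [v])
  simpa [hqe, hev, Pi.single_apply] using hpos

section HaarMeasure

variable {V W : Type*} [NormedAddCommGroup V] [NormedSpace ℝ V] [FiniteDimensional ℝ V]
  [MeasurableSpace V] [BorelSpace V] [NormedAddCommGroup W] [NormedSpace ℝ W]
  [FiniteDimensional ℝ W] [MeasurableSpace W] [BorelSpace W]

theorem exists_pos_integral_comp_linearEquiv (ν : Measure V) [ν.IsAddHaarMeasure] (ν' : Measure W)
    [ν'.IsAddHaarMeasure] (e : V ≃ₗ[ℝ] W) :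
    ∃ r : ℝ, 0 < r ∧ ∀ g : W → ℂ, ∫ v, g (e v) ∂ν = r * ∫ w, g w ∂ν' := by
  set e' : V ≃L[ℝ] W := e.toContinuousLinearEquiv
  have : (ν.map e').IsAddHaarMeasure := e'.isAddHaarMeasure_map ν
  refine ⟨(ν.map e').addHaarScalarFactor ν', mod_cast
    Measure.addHaarScalarFactor_pos_of_isAddHaarMeasure _ _, fun g => ?_⟩
  have hmap : ∫ w, g w ∂ν.map e' = ∫ v, g (e v) ∂ν :=
    integral_map_equiv e'.toHomeomorph.toMeasurableEquiv g
  rw [← hmap]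
  conv_lhs => rw [Measure.isAddLeftInvariant_eq_smul (ν.map e') ν', integral_smul_nnreal_measure]
  rfl

theorem exists_pos_integral_cexp_neg_sum_mul_sq {ι : Type*} [Fintype ι] {w : ι → ℝ}
    (hw : ∀ i, 0 < w i) (c : ι → ℝ) : ∃ r : ℝ, 0 < r ∧
      ∫ v : ι → ℝ, Complex.exp (-∑ i, (w i : ℂ) * (v i : ℂ) ^ 2 + ∑ i, Complex.I * c i * v i)
        = r := by
  refine ⟨∏ i, (Real.pi / w i) ^ (1 / 2 : ℝ) * Real.exp (-(c i) ^ 2 / (4 * w i)),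
    Finset.prod_pos fun i _ => ?_, ?_⟩
  · exact mul_pos (Real.rpow_pos_of_pos (div_pos Real.pi_pos (hw i)) _) (Real.exp_pos _)
  · rw [GaussianFourier.integral_cexp_neg_sum_mul_add (b := fun i => (w i : ℂ))
      (fun i => by simpa using hw i) fun i => Complex.I * c i, Complex.ofReal_prod]
    refine Finset.prod_congr rfl fun i _ => ?_
    rw [Complex.ofReal_mul, Complex.ofReal_cpow (div_pos Real.pi_pos (hw i)).le,
      Complex.ofReal_exp, mul_pow, Complex.I_sq]
    push_cast
    rw [neg_one_mul]

theorem exists_pos_integral_cexp_neg_quadraticForm (ν : Measure V) [ν.IsAddHaarMeasure]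
    {q : QuadraticForm ℝ V} (hq : q.PosDef) (ℓ : Module.Dual ℝ V) :
    ∃ r : ℝ, 0 < r ∧ ∫ v, Complex.exp (-(q v : ℂ) + Complex.I * (ℓ v : ℂ)) ∂ν = r := by
  obtain ⟨w, e, hw, hqe⟩ := exists_linearEquiv_sum_mul_sq hq
  obtain ⟨s, hs_pos, hs⟩ := exists_pos_integral_comp_linearEquiv ν volume e
  set c : Fin (Module.finrank ℝ V) → ℝ := fun i => ℓ (e.symm (Pi.single i 1))
  obtain ⟨r, hr_pos, hr⟩ := exists_pos_integral_cexp_neg_sum_mul_sq hw c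
  have hℓ : ∀ v, ℓ v = ∑ i, c i * e v i := fun v => by
    have h := LinearMap.pi_apply_eq_sum_univ (ℓ ∘ₗ e.symm.toLinearMap) (e v)
    simp only [LinearMap.comp_apply, LinearEquiv.coe_coe, e.symm_apply_apply, smul_eq_mul] at h
    rw [h]
    refine Finset.sum_congr rfl fun i _ => ?_
    rw [mul_comm]
    congr 3
    ext j
    simp [Pi.single_apply, eq_comm]
  refine ⟨s * r, mul_pos hs_pos hr_pos, ?_⟩
  rw [Complex.ofReal_mul, ← hr, ← hs]
  refine integral_congr_ae (.of_forall fun v => ?_)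
  simp only [hqe, hℓ, Complex.ofReal_sum, Complex.ofReal_mul, Complex.ofReal_pow, Finset.mul_sum,
    mul_assoc]

end HaarMeasure

/-! ### Gaussian states -/

/-- The real-bilinear form `∑_{jk} ξⱼ A_{jk} η_k` whose diagonal is `quad A`. -/
def bilin (A : Matrix (Fin n) (Fin n) ℂ) : (Fin n → ℝ) →ₗ[ℝ] (Fin n → ℝ) →ₗ[ℝ] ℂ :=
  Matrix.toLinearMap₂' ℝ A

theorem bilin_apply (A : Matrix (Fin n) (Fin n) ℂ) (ξ η : Fin n → ℝ) :
    bilin A ξ η = ∑ j, ∑ k, (ξ j : ℂ) * A j k * (η k : ℂ) := by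
  simp only [bilin, Matrix.toLinearMap₂'_apply, Complex.real_smul]
  exact Finset.sum_congr rfl fun j _ => Finset.sum_congr rfl fun k _ => by ring

theorem bilin_self (A : Matrix (Fin n) (Fin n) ℂ) (ξ : Fin n → ℝ) : bilin A ξ ξ = quad A ξ :=
  bilin_apply A ξ ξ

theorem bilin_comm {A : Matrix (Fin n) (Fin n) ℂ} (hs : A.IsSymm) (ξ η : Fin n → ℝ) :
    bilin A ξ η = bilin A η ξ := by
  rw [bilin_apply, bilin_apply, Finset.sum_comm]
  refine Finset.sum_congr rfl fun j _ => Finset.sum_congr rfl fun k _ => ?_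
  rw [hs.apply]
  ring

theorem bilin_single_left (A : Matrix (Fin n) (Fin n) ℂ) (j : Fin n) (ξ : Fin n → ℝ) :
    bilin A (Pi.single j 1) ξ = ∑ k, A j k * ξ k := by
  rw [bilin_apply, Finset.sum_eq_single_of_mem j (Finset.mem_univ j)]
  · simp
  · intro i _ hij
    simp [hij]

theorem quad_add_smul {A : Matrix (Fin n) (Fin n) ℂ} (hs : A.IsSymm) (ξ v : Fin n → ℝ) (t : ℝ) :
    quad A (ξ + t • v) = quad A ξ + 2 * t * bilin A v ξ + (t : ℂ) ^ 2 * quad A v := by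
  simp only [← bilin_self, map_add, LinearMap.add_apply, map_smul, LinearMap.smul_apply,
    Complex.real_smul, bilin_comm hs ξ v]
  ring

/-- The quadratic form `Im ∑_{jk} ξⱼ A_{jk} ξ_k`. -/
def imQuad (A : Matrix (Fin n) (Fin n) ℂ) : QuadraticForm ℝ (Fin n → ℝ) :=
  LinearMap.BilinMap.toQuadraticMap ((bilin A).compr₂ Complex.imLm)

theorem imQuad_apply (A : Matrix (Fin n) (Fin n) ℂ) (ξ : Fin n → ℝ) :
    imQuad A ξ = (quad A ξ).im := by
  rw [← bilin_self]
  rfl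

theorem ImPos.posDef_imQuad {A : Matrix (Fin n) (Fin n) ℂ} (hA : ImPos A) : (imQuad A).PosDef :=
  fun ξ hξ => (imQuad_apply A ξ).symm ▸ hA ξ hξ

theorem gaussian_apply {A : Matrix (Fin n) (Fin n) ℂ} (hA : ImPos A) (ξ : Fin n → ℝ) :
    gaussian A hA ξ = Complex.exp (Complex.I / 2 * quad A ξ) := rfl

theorem exists_isSymm_gaussian_eq {A : Matrix (Fin n) (Fin n) ℂ} (hA : ImPos A) :
    ∃ (B : Matrix (Fin n) (Fin n) ℂ) (hB : ImPos B), B.IsSymm ∧ gaussian B hB = gaussian A hA := by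
  set B : Matrix (Fin n) (Fin n) ℂ := (1 / 2 : ℂ) • (A + A.transpose)
  have hquad : ∀ ξ, quad B ξ = quad A ξ := fun ξ => by
    have htranspose : quad A.transpose ξ = quad A ξ := by
      rw [quad, Finset.sum_comm]
      exact Finset.sum_congr rfl fun j _ => Finset.sum_congr rfl fun k _ => by
        rw [Matrix.transpose_apply]
        ring
    have hadd : quad B ξ = (1 / 2) * (quad A ξ + quad A.transpose ξ) := by
      simp only [quad, B, Matrix.smul_apply, Matrix.add_apply, smul_eq_mul, Finset.mul_sum,
        ← Finset.sum_add_distrib]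
      exact Finset.sum_congr rfl fun j _ => Finset.sum_congr rfl fun k _ => by ring
    rw [hadd, htranspose]
    ring
  have hB : ImPos B := fun ξ hξ => by
    rw [hquad]
    exact hA ξ hξ
  refine ⟨B, hB, (Matrix.isSymm_add_transpose_self A).smul _, ?_⟩
  ext ξ
  rw [gaussian_apply, gaussian_apply, hquad]

theorem hasLineDerivAt_gaussian {A : Matrix (Fin n) (Fin n) ℂ} (hs : A.IsSymm) (hA : ImPos A)
    (ξ v : Fin n → ℝ) :
    HasLineDerivAt ℝ (gaussian A hA) (Complex.I * bilin A v ξ * gaussian A hA ξ) ξ v := by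
  have hid : HasDerivAt (fun t : ℝ => (t : ℂ)) 1 0 := (hasDerivAt_id (0 : ℝ)).ofReal_comp
  have hquad := (((((hid.const_mul 2).mul_const (bilin A v ξ)).const_add (quad A ξ)).add
    ((hid.pow 2).mul_const (quad A v))).const_mul (Complex.I / 2)).cexp
  refine (hquad.congr_of_eventuallyEq (.of_forall fun t => ?_)).congr_deriv ?_
  · rw [gaussian_apply, quad_add_smul hs]
    rfl
  · simp only [Pi.pow_apply, Pi.add_apply, Complex.ofReal_zero, mul_zero, zero_mul, add_zero, ne_eq,
      OfNat.ofNat_ne_zero, not_false_eq_true, zero_pow, mul_one, Nat.cast_ofNat,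
      Nat.add_one_sub_one, pow_one, gaussian_apply]
    ring

theorem fderiv_gaussian {A : Matrix (Fin n) (Fin n) ℂ} (hs : A.IsSymm) (hA : ImPos A)
    (ξ v : Fin n → ℝ) :
    fderiv ℝ (gaussian A hA) ξ v = Complex.I * bilin A v ξ * gaussian A hA ξ :=
  (((gaussian A hA).hasFDerivAt ξ).hasLineDerivAt v).unique (hasLineDerivAt_gaussian hs hA ξ v)

/-- The linear functional `ξ ↦ P·ξ - Re (Q·Aξ)`: its exponential is the phase of the overlap of
`ψ_A` with `e^{iΩ(P,Q)} ψ_A`. -/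
def overlapPhase (A : Matrix (Fin n) (Fin n) ℂ) (X : Phase ℝ n) : Module.Dual ℝ (Fin n → ℝ) :=
  dotProductBilin ℝ ℝ X.1 - Complex.reLm ∘ₗ bilin A X.2

/-- Centring the overlap integrand at `Q/2` cancels its linear real part. -/
theorem conj_gaussian_mul_weylOp_gaussian {A : Matrix (Fin n) (Fin n) ℂ} (hs : A.IsSymm)
    (hA : ImPos A) (X : Phase ℝ n) (ξ : Fin n → ℝ) :
    conj (gaussian A hA (ξ + (1 / 2 : ℝ) • X.2)) *
        weylOp X (gaussian A hA) (ξ + (1 / 2 : ℝ) • X.2)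
      = Real.exp (-(quad A X.2).im / 4) *
        Complex.exp (-(imQuad A ξ : ℂ) + Complex.I * (overlapPhase A X ξ : ℂ)) := by
  have hshift : ξ + (1 / 2 : ℝ) • X.2 - X.2 = ξ + (-(1 / 2) : ℝ) • X.2 := by
    module
  have hphase : ∑ j, X.1 j * (ξ + (1 / 2 : ℝ) • X.2) j - (∑ j, X.1 j * X.2 j) / 2
      = overlapPhase A X ξ + (bilin A X.2 ξ).re := by
    simp only [overlapPhase, LinearMap.sub_apply, LinearMap.comp_apply, Complex.reLm_coe,
      sub_add_cancel, dotProductBilin_apply_apply, dotProduct, Pi.add_apply, Pi.smul_apply,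
      smul_eq_mul, mul_add, Finset.sum_add_distrib, Finset.sum_div]
    rw [add_sub_assoc, ← Finset.sum_sub_distrib, add_eq_left]
    exact Finset.sum_eq_zero fun j _ => by ring
  have hconj : ∀ z : ℂ, conj z = z - 2 * z.im * Complex.I := fun z => by
    rw [← Complex.ofReal_ofNat, ← Complex.ofReal_mul, ← Complex.sub_conj, sub_sub_cancel]
  have hre : ∀ z : ℂ, conj z = 2 * z.re - z := fun z => by
    rw [← Complex.ofReal_ofNat, ← Complex.ofReal_mul, ← Complex.add_conj, add_sub_cancel_left]
  simp only [weylOp_apply, weylPhase, gaussian_apply, ← Complex.exp_conj, Complex.ofReal_exp,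
    ← Complex.exp_add, hphase, hshift, quad_add_smul hs, imQuad_apply, map_mul, map_div₀, map_add,
    map_pow, Complex.conj_I, Complex.conj_ofReal, Complex.conj_ofNat, hconj (quad A ξ),
    hconj (quad A X.2), hre (bilin A X.2 ξ)]
  congr 1
  push_cast
  linear_combination ((quad A ξ).im + (quad A X.2).im / 4 : ℂ) * Complex.I_sq

theorem exists_l2Inner_gaussian_weylOp_pos {A : Matrix (Fin n) (Fin n) ℂ} (hs : A.IsSymm)
    (hA : ImPos A) (X : Phase ℝ n) : ∃ r : ℝ, 0 < r ∧
      l2Inner (gaussian A hA) (weylOp X (gaussian A hA)) = r := by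
  obtain ⟨r, hr_pos, hr⟩ := exists_pos_integral_cexp_neg_quadraticForm volume hA.posDef_imQuad
    (overlapPhase A X)
  refine ⟨Real.exp (-(quad A X.2).im / 4) * r, mul_pos (Real.exp_pos _) hr_pos, ?_⟩
  rw [Complex.ofReal_mul, ← hr, ← integral_const_mul, l2Inner,
    ← integral_add_right_eq_self _ ((1 / 2 : ℝ) • X.2)]
  exact integral_congr_ae (.of_forall (conj_gaussian_mul_weylOp_gaussian hs hA X))

theorem l2Inner_gaussian_self_ne_zero {A : Matrix (Fin n) (Fin n) ℂ} (hs : A.IsSymm)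
    (hA : ImPos A) : l2Inner (gaussian A hA) (gaussian A hA) ≠ 0 := by
  obtain ⟨r, hr_pos, hr⟩ := exists_l2Inner_gaussian_weylOp_pos hs hA 0
  rw [weylOp_zero] at hr
  exact hr ▸ mod_cast hr_pos.ne'

theorem not_isNull_gaussian {L : Submodule ℝ (Phase ℝ n)} {μ : Measure L} [μ.IsAddHaarMeasure]
    {A : Matrix (Fin n) (Fin n) ℂ} (hA : ImPos A) : ¬ IsNull L μ (gaussian A hA) := by
  obtain ⟨B, hB, hs, hBA⟩ := exists_isSymm_gaussian_eq hA
  rw [← hBA, IsNull, physInner_eq]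
  choose r hr_pos hr using exists_l2Inner_gaussian_weylOp_pos hs hB
  have hint := (integrable_l2Inner_weylOp (L := L) (μ := μ) (gaussian B hB) (gaussian B hB)).re
  simp only [hr, RCLike.re_to_complex, Complex.ofReal_re] at hint ⊢
  rw [integral_complex_ofReal, Complex.ofReal_eq_zero]
  refine ((integral_pos_iff_support_of_nonneg (fun X : L => (hr_pos X).le) hint).2 ?_).ne'
  rw [Function.support_eq_univ fun X : L => (hr_pos X).ne']
  exact Measure.measure_univ_pos.2 (NeZero.ne μ)

/-! ### The symbol of `Ω(Y)` on a Gaussian state -/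

/-- The symbol `P - AQ` of `Y = (P, Q)`: the coefficients of the linear form by which `Ω(Y)`
multiplies the Gaussian state `ψ_A`. -/
def gaussSymbol (A : Matrix (Fin n) (Fin n) ℂ) : Phase ℂ n →ₗ[ℂ] (Fin n → ℂ) :=
  LinearMap.fst ℂ _ _ - A.mulVecLin ∘ₗ LinearMap.snd ℂ _ _

theorem gaussSymbol_apply (A : Matrix (Fin n) (Fin n) ℂ) (Y : Phase ℂ n) :
    gaussSymbol A Y = Y.1 - A.mulVec Y.2 := rfl

theorem Omega_gaussian_apply {A : Matrix (Fin n) (Fin n) ℂ} (hs : A.IsSymm) (hA : ImPos A)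
    (Y : Phase ℂ n) (ξ : Fin n → ℝ) :
    Omega Y (gaussian A hA) ξ = (∑ j, gaussSymbol A Y j * ξ j) * gaussian A hA ξ := by
  have htranspose : ∑ j, Y.2 j * ∑ k, A j k * (ξ k : ℂ) = ∑ j, A.mulVec Y.2 j * ξ j := by
    simp only [Matrix.mulVec, dotProduct, Finset.mul_sum, Finset.sum_mul]
    rw [Finset.sum_comm]
    refine Finset.sum_congr rfl fun j _ => Finset.sum_congr rfl fun k _ => ?_
    rw [hs.apply]
    ring
  simp only [gaussSymbol_apply, Pi.sub_apply, sub_mul, Finset.sum_sub_distrib, ← htranspose]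
  rw [Omega_apply, ← sub_mul, ← Finset.sum_sub_distrib, Finset.sum_mul]
  refine Finset.sum_congr rfl fun j _ => ?_
  have hI := Complex.I_ne_zero
  rw [fderiv_gaussian hs, bilin_single_left]
  field_simp

theorem Omega_gaussian_congr {A : Matrix (Fin n) (Fin n) ℂ} (hs : A.IsSymm) (hA : ImPos A)
    {Y Z : Phase ℂ n} (h : gaussSymbol A Y = gaussSymbol A Z) :
    Omega Y (gaussian A hA) = Omega Z (gaussian A hA) := by
  ext ξ
  rw [Omega_gaussian_apply hs, Omega_gaussian_apply hs, h]

theorem gaussSymbol_conj (A : Matrix (Fin n) (Fin n) ℂ) (Y : Phase ℂ n) :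
    gaussSymbol A Y.conj = fun j => conj (gaussSymbol (A.map (starRingEnd ℂ)) Y j) := by
  ext j
  simp [gaussSymbol_apply, Phase.conj, Matrix.mulVec, dotProduct]

theorem le_finrank_ker_gaussSymbol (A : Matrix (Fin n) (Fin n) ℂ) :
    n ≤ Module.finrank ℂ (LinearMap.ker (gaussSymbol A)) := by
  have hrank := LinearMap.finrank_range_add_finrank_ker (gaussSymbol A)
  have hrange := Submodule.finrank_le (LinearMap.range (gaussSymbol A))
  rw [Module.finrank_prod] at hrank
  simp only [Module.finrank_fin_fun] at hrank hrange
  lia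

/-! ### Positivity of `Im ω(Y, Ȳ)` on the Lagrangian plane `P = AQ` -/

theorem sum_mulVec_mul_conj {A : Matrix (Fin n) (Fin n) ℂ} (hs : A.IsSymm) (Q : Fin n → ℂ) :
    ∑ j, A.mulVec Q j * conj (Q j)
      = quad A (fun j => (Q j).re) + quad A (fun j => (Q j).im) := by
  have hexpand : ∑ j, A.mulVec Q j * conj (Q j)
      = quad A (fun j => (Q j).re) + quad A (fun j => (Q j).im)
        + Complex.I * (bilin A (fun j => (Q j).re) (fun j => (Q j).im)
          - bilin A (fun j => (Q j).im) (fun j => (Q j).re)) := by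
    simp only [Matrix.mulVec, dotProduct, quad, bilin_apply, Finset.sum_mul, Finset.mul_sum,
      ← Finset.sum_add_distrib, ← Finset.sum_sub_distrib]
    refine Finset.sum_congr rfl fun j _ => Finset.sum_congr rfl fun k _ => ?_
    have hj : conj (Q j) = (Q j).re - (Q j).im * Complex.I := Complex.ext (by simp) (by simp)
    have hk : Q k = (Q k).re + (Q k).im * Complex.I := (Complex.re_add_im _).symm
    rw [hj]
    conv_lhs => rw [hk]
    linear_combination -A j k * (Q j).im * (Q k).im * Complex.I_sq
  rw [hexpand, bilin_comm hs, sub_self, mul_zero, add_zero]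

theorem im_omega_conj_self {A : Matrix (Fin n) (Fin n) ℂ} (hs : A.IsSymm) {Y : Phase ℂ n}
    (hY : gaussSymbol A Y = 0) : (omega Y Y.conj).im
      = 2 * (imQuad A (fun j => (Y.2 j).re) + imQuad A fun j => (Y.2 j).im) := by
  have hY₁ : Y.1 = A.mulVec Y.2 := sub_eq_zero.1 hY
  have homega : omega Y Y.conj = (∑ j, A.mulVec Y.2 j * conj (Y.2 j))
      - conj (∑ j, A.mulVec Y.2 j * conj (Y.2 j)) := by
    simp only [omega, Phase.conj, hY₁, map_sum, map_mul, Complex.conj_conj,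
      Finset.sum_sub_distrib]
  rw [homega, sum_mulVec_mul_conj hs, Complex.sub_im, Complex.conj_im, sub_neg_eq_add,
    ← two_mul, Complex.add_im, imQuad_apply, imQuad_apply]

theorem im_omega_conj_self_nonneg {A : Matrix (Fin n) (Fin n) ℂ} (hs : A.IsSymm) (hA : ImPos A)
    {Y : Phase ℂ n} (hY : gaussSymbol A Y = 0) : 0 ≤ (omega Y Y.conj).im := by
  rw [im_omega_conj_self hs hY]
  exact mul_nonneg zero_le_two
    (add_nonneg (hA.posDef_imQuad.nonneg _) (hA.posDef_imQuad.nonneg _))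

theorem eq_zero_of_im_omega_conj_self_nonpos {A : Matrix (Fin n) (Fin n) ℂ} (hs : A.IsSymm)
    (hA : ImPos A) {Y : Phase ℂ n} (hY : gaussSymbol A Y = 0) (h : (omega Y Y.conj).im ≤ 0) :
    Y = 0 := by
  have hq := hA.posDef_imQuad
  have hre := hq.nonneg fun j => (Y.2 j).re
  have him := hq.nonneg fun j => (Y.2 j).im
  rw [im_omega_conj_self hs hY] at h
  have hre₀ : (fun j => (Y.2 j).re) = 0 := hq.anisotropic _ (by linarith)
  have him₀ : (fun j => (Y.2 j).im) = 0 := hq.anisotropic _ (by linarith)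
  have hY₂ : Y.2 = 0 := funext fun j => Complex.ext (congrFun hre₀ j) (congrFun him₀ j)
  rw [gaussSymbol_apply, hY₂, Matrix.mulVec_zero, sub_zero] at hY
  exact Prod.ext hY hY₂

/-! ### The Lagrangian plane of a Gaussian state -/

theorem conj_mem_complexSpan {L : Submodule ℝ (Phase ℝ n)} {Y : Phase ℂ n}
    (hY : Y ∈ complexSpan L) : Y.conj ∈ complexSpan L := by
  induction hY using Submodule.span_induction with
  | mem Y hY =>
    obtain ⟨X, hX, rfl⟩ := hY
    rw [Phase.conj_toComplex]
    exact Submodule.subset_span ⟨X, hX, rfl⟩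
  | zero => exact Phase.conj_zero.symm ▸ zero_mem _
  | add Y Z _ _ hY hZ => exact Phase.conj_add Y Z ▸ add_mem hY hZ
  | smul c Y _ hY => exact Phase.conj_smul c Y ▸ Submodule.smul_mem _ _ hY

/-- The complexified symplectic form as a bilinear map. -/
def omegaForm : Phase ℂ n →ₗ[ℂ] Phase ℂ n →ₗ[ℂ] ℂ :=
  LinearMap.mk₂ ℂ omega omega_add_left omega_smul_left omega_add_right omega_smul_right

theorem omega_eq_zero_of_mem_skewComplement {L : Submodule ℝ (Phase ℝ n)} {Y Z : Phase ℂ n}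
    (hY : Y ∈ skewComplement L) (hZ : Z ∈ complexSpan L) : omega Y Z = 0 := by
  have hker : complexSpan L ≤ LinearMap.ker (omegaForm Y) := Submodule.span_le.2 <| by
    rintro _ ⟨X, hX, rfl⟩
    exact hY X hX
  exact hker hZ

theorem complexSpan_le_skewComplement {L : Submodule ℝ (Phase ℝ n)} (hL : IsIsotropic L) :
    complexSpan L ≤ skewComplement L := Submodule.span_le.2 <| by
  rintro _ ⟨X, hX, rfl⟩ X' hX'
  rw [omega_toComplex, hL X hX X' hX', Complex.ofReal_zero]

theorem omega_add_conj_self {L : Submodule ℝ (Phase ℝ n)} (hL : IsIsotropic L) {X R : Phase ℂ n}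
    (hX : X ∈ complexSpan L) (hR : R ∈ skewComplement L) :
    omega (X + R) (X + R).conj = omega R R.conj := by
  have hXconj := conj_mem_complexSpan hX
  rw [Phase.conj_add, omega_add_left, omega_add_right, omega_add_right, omega_swap X R.conj,
    omega_eq_zero_of_mem_skewComplement (complexSpan_le_skewComplement hL hX) hXconj,
    omega_eq_zero_of_mem_skewComplement (conj_mem_skewComplement hR) hX,
    omega_eq_zero_of_mem_skewComplement hR hXconj, neg_zero, zero_add, zero_add, zero_add]

theorem finrank_le_finrank_inf_skewComplement_add (L : Submodule ℝ (Phase ℝ n))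
    (V : Submodule ℂ (Phase ℂ n)) :
    Module.finrank ℂ V
      ≤ Module.finrank ℂ (V ⊓ skewComplement L : Submodule ℂ (Phase ℂ n))
        + Module.finrank ℂ (complexSpan L) := by
  let pairing : V →ₗ[ℂ] Module.Dual ℂ (complexSpan L) :=
    (complexSpan L).dualRestrict ∘ₗ omegaForm ∘ₗ V.subtype
  have hker : (LinearMap.ker pairing).map V.subtype ≤ V ⊓ skewComplement L := by
    rintro _ ⟨Y, hY, rfl⟩
    exact ⟨Y.2, fun X hX => LinearMap.congr_fun hY ⟨_, Submodule.subset_span ⟨X, hX, rfl⟩⟩⟩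
  have hker_le := Submodule.finrank_mono hker
  have hrange_le := Submodule.finrank_le (LinearMap.range pairing)
  rw [Submodule.finrank_map_subtype_eq] at hker_le
  rw [Subspace.dual_finrank_eq] at hrange_le
  rw [← LinearMap.finrank_range_add_finrank_ker pairing]
  lia

/-- The Lagrangian plane spanned by `L` and the part of the plane `P = AQ` that is
skew-orthogonal to `L`. Its elements belong to the H-germ of `ψ_A`. -/
def lagrangianPlane (L : Submodule ℝ (Phase ℝ n)) (A : Matrix (Fin n) (Fin n) ℂ) :
    Submodule ℂ (Phase ℂ n) :=
  complexSpan L ⊔ LinearMap.ker (gaussSymbol A) ⊓ skewComplement L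

theorem lagrangianPlane_le_skewComplement {L : Submodule ℝ (Phase ℝ n)} (hL : IsIsotropic L)
    (A : Matrix (Fin n) (Fin n) ℂ) : lagrangianPlane L A ≤ skewComplement L :=
  sup_le (complexSpan_le_skewComplement hL) inf_le_right

section Lagrangian

variable {L : Submodule ℝ (Phase ℝ n)} {A : Matrix (Fin n) (Fin n) ℂ}

theorem le_finrank_lagrangianPlane (hL : IsIsotropic L) (hs : A.IsSymm) (hA : ImPos A) :
    n ≤ Module.finrank ℂ (lagrangianPlane L A) := by
  have hdisjoint : complexSpan L ⊓ (LinearMap.ker (gaussSymbol A) ⊓ skewComplement L) = ⊥ := by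
    refine (Submodule.eq_bot_iff _).2 fun Y ⟨hYL, hYA, _⟩ => ?_
    refine eq_zero_of_im_omega_conj_self_nonpos hs hA hYA ?_
    rw [omega_eq_zero_of_mem_skewComplement (complexSpan_le_skewComplement hL hYL)
      (conj_mem_complexSpan hYL), Complex.zero_im]
  have hsup := Submodule.finrank_sup_add_finrank_inf_eq (complexSpan L)
    (LinearMap.ker (gaussSymbol A) ⊓ skewComplement L)
  rw [hdisjoint, finrank_bot, add_zero] at hsup
  rw [lagrangianPlane, hsup, add_comm]
  exact (le_finrank_ker_gaussSymbol A).trans (finrank_le_finrank_inf_skewComplement_add L _)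

/-- `Im ω(Y, Ȳ) ≥ 0` on the Lagrangian plane, whereas `Im ω(Ȳ, Y) > 0` for `Y ≠ 0` whose
conjugate has vanishing symbol. -/
theorem eq_zero_of_gaussSymbol_conj_eq_zero (hL : IsIsotropic L) (hs : A.IsSymm) (hA : ImPos A)
    {Y : Phase ℂ n} (hY : Y ∈ lagrangianPlane L A) (h : gaussSymbol A Y.conj = 0) : Y = 0 := by
  obtain ⟨X, hX, R, ⟨hRA, hRL⟩, rfl⟩ := Submodule.mem_sup.1 hY
  have hnonneg := im_omega_conj_self_nonneg hs hA hRA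
  rw [← omega_add_conj_self hL hX hRL, omega_swap, Complex.neg_im, neg_nonneg] at hnonneg
  have hconj : (X + R).conj = 0 :=
    eq_zero_of_im_omega_conj_self_nonpos hs hA h (by rwa [Phase.conj_conj])
  rw [← Phase.conj_conj (X + R), hconj, Phase.conj_zero]

theorem exists_mem_lagrangianPlane_gaussSymbol_conj_eq (hL : IsIsotropic L) (hs : A.IsSymm)
    (hA : ImPos A) (l : Fin n → ℂ) : ∃ Y ∈ lagrangianPlane L A, gaussSymbol A Y.conj = l := by
  let symbol := (gaussSymbol (A.map (starRingEnd ℂ))).domRestrict (lagrangianPlane L A)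
  have hinj : Function.Injective symbol := (injective_iff_map_eq_zero symbol).2 fun Y hY => by
    refine Subtype.ext (eq_zero_of_gaussSymbol_conj_eq_zero hL hs hA Y.2 ?_)
    rw [gaussSymbol_conj, show gaussSymbol (A.map (starRingEnd ℂ)) Y = 0 from hY]
    simp only [Pi.zero_apply, map_zero]
    rfl
  have hfinrank : Module.finrank ℂ (lagrangianPlane L A) = Module.finrank ℂ (Fin n → ℂ) :=
    (LinearMap.finrank_le_finrank_of_injective hinj).antisymm <| by
      rw [Module.finrank_fin_fun]
      exact le_finrank_lagrangianPlane hL hs hA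
  obtain ⟨Y, hY⟩ := (LinearMap.injective_iff_surjective_of_finrank_eq_finrank hfinrank).1 hinj
    fun j => conj (l j)
  refine ⟨Y, Y.2, ?_⟩
  rw [gaussSymbol_conj, show gaussSymbol (A.map (starRingEnd ℂ)) Y = _ from hY]
  simp only [Complex.conj_conj]

end Lagrangian

/-! ### Annihilators of vectors of the constrained Hilbert space -/

/-- The operators `Ω(Y)` of the constrained theory that annihilate the vector defined by `ψ`; the
H-germ of `A` is the annihilator of the Gaussian state `ψ_A`. -/
def annihilator (L : Submodule ℝ (Phase ℝ n)) (μ : Measure L) (ψ : 𝓢(Fin n → ℝ, ℂ)) :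
    Set (Phase ℂ n) :=
  {Y | Y ∈ skewComplement L ∧ IsNull L μ (Omega Y ψ)}

theorem hGerm_eq_annihilator (L : Submodule ℝ (Phase ℝ n)) (μ : Measure L)
    {A : Matrix (Fin n) (Fin n) ℂ} (hA : ImPos A) :
    hGerm L μ A hA = annihilator L μ (gaussian A hA) := rfl

theorem eq_zero_of_hasDerivAt_mul_self {h : ℝ → ℂ} {κ : ℂ}
    (hderiv : ∀ t : ℝ, HasDerivAt h (t * κ * h t) t) (h₀ : h 0 = 0) (t : ℝ) : h t = 0 := by
  have hconst : ∀ t : ℝ,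
      HasDerivAt (fun t : ℝ => h t * Complex.exp (-(κ / 2 * (t : ℂ) ^ 2))) 0 t := fun t => by
    have hid : HasDerivAt (fun t : ℝ => (t : ℂ)) 1 t := (hasDerivAt_id t).ofReal_comp
    refine ((hderiv t).mul (((hid.pow 2).const_mul (κ / 2)).neg).cexp).congr_deriv ?_
    simp only [Pi.pow_apply, Nat.cast_ofNat]
    ring
  have heq := is_const_of_deriv_eq_zero (fun t => (hconst t).differentiableAt)
    (fun t => (hconst t).deriv) t 0
  simp only [h₀, zero_mul] at heq
  exact (mul_eq_zero.1 heq).resolve_right (Complex.exp_ne_zero _)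

section Annihilator

variable {L : Submodule ℝ (Phase ℝ n)} {μ : Measure L} [μ.IsAddHaarMeasure]

theorem lagrangianPlane_subset_annihilator (hL : IsIsotropic L) {A : Matrix (Fin n) (Fin n) ℂ}
    (hs : A.IsSymm) (hA : ImPos A) :
    (lagrangianPlane L A : Set (Phase ℂ n)) ⊆ annihilator L μ (gaussian A hA) := fun Y hY => by
  refine ⟨lagrangianPlane_le_skewComplement hL A hY, ?_⟩
  obtain ⟨X, hX, R, ⟨hRA, _⟩, rfl⟩ := Submodule.mem_sup.1 hY
  have hsymbol : gaussSymbol A (X + R) = gaussSymbol A X := by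
    rw [map_add, show gaussSymbol A R = 0 from hRA, add_zero]
  rw [Omega_gaussian_congr hs hA hsymbol]
  exact isNull_Omega_of_mem_complexSpan hL hX _

/-- Choosing `Y` in the H-germ such that `Ω(Ȳ)` and `Ω(Z)` agree on `ψ_A`, one may move `Ω(Ȳ)` to
the other side of the inner product, where it annihilates `f`. -/
theorem hasDerivAt_physInner_weylOp_gaussian (hL : IsIsotropic L)
    {A : Matrix (Fin n) (Fin n) ℂ} (hs : A.IsSymm) (hA : ImPos A) {f : 𝓢(Fin n → ℝ, ℂ)}
    (hf : annihilator L μ (gaussian A hA) ⊆ annihilator L μ f) (Z : Phase ℝ n) :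
    ∃ κ : ℂ, ∀ t : ℝ, HasDerivAt (fun s : ℝ => physInner L μ (weylOp (s • Z) (gaussian A hA)) f)
      (t * κ * physInner L μ (weylOp (t • Z) (gaussian A hA)) f) t := by
  obtain ⟨Y, hY, hYZ⟩ :=
    exists_mem_lagrangianPlane_gaussSymbol_conj_eq hL hs hA (gaussSymbol A Z.toComplex)
  obtain ⟨hYL, hYf⟩ := hf (lagrangianPlane_subset_annihilator hL hs hA hY)
  refine ⟨Complex.I * conj (omega Y.conj Z.toComplex), fun t => ?_⟩
  refine (hasDerivAt_physInner_weylOp_smul Z (gaussian A hA) f t).congr_deriv ?_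
  have hcommute : weylOp (t • Z) (Omega Z.toComplex (gaussian A hA))
      = Omega Y.conj (weylOp (t • Z) (gaussian A hA))
        + (-(t * omega Y.conj Z.toComplex)) • weylOp (t • Z) (gaussian A hA) := by
    rw [Omega_weylOp, ← Omega_gaussian_congr hs hA hYZ, Phase.toComplex_smul, omega_smul_right,
      neg_smul, add_neg_cancel_right]
  rw [map_smul, hcommute, physInner_smul_left, physInner_add_left, physInner_smul_left,
    physInner_Omega_left (conj_mem_skewComplement hYL), Phase.conj_conj, hYf.physInner_right hL]
  simp only [Complex.conj_I, map_neg, map_mul, Complex.conj_ofReal]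
  ring

theorem isNull_of_annihilator_subset_of_orthogonal (hL : IsIsotropic L)
    {A : Matrix (Fin n) (Fin n) ℂ} (hs : A.IsSymm) (hA : ImPos A) {f : 𝓢(Fin n → ℝ, ℂ)}
    (hf : annihilator L μ (gaussian A hA) ⊆ annihilator L μ f)
    (horthogonal : physInner L μ (gaussian A hA) f = 0) : IsNull L μ f := by
  refine isNull_of_physInner_weylOp_eq_zero (l2Inner_gaussian_self_ne_zero hs hA) fun Z => ?_
  obtain ⟨κ, hκ⟩ := hasDerivAt_physInner_weylOp_gaussian hL hs hA hf Z
  have h := eq_zero_of_hasDerivAt_mul_self hκ (by rwa [zero_smul, weylOp_zero]) 1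
  rwa [one_smul] at h

theorem annihilator_smul (hL : IsIsotropic L) {c : ℂ} (hc : c ≠ 0) (ψ : 𝓢(Fin n → ℝ, ℂ)) :
    annihilator L μ (c • ψ) = annihilator L μ ψ := by
  ext Y
  refine and_congr_right fun _ => ?_
  rw [map_smul, ← mem_nullSubmodule hL, Submodule.smul_mem_iff _ hc, mem_nullSubmodule]

theorem annihilator_congr (hL : IsIsotropic L) {ψ₁ ψ₂ : 𝓢(Fin n → ℝ, ℂ)}
    (h : PhysEquiv L μ ψ₁ ψ₂) : annihilator L μ ψ₁ = annihilator L μ ψ₂ := by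
  ext Y
  refine and_congr_right fun hY => ?_
  have hsub : Omega Y ψ₁ - Omega Y ψ₂ ∈ nullSubmodule hL μ := by
    rw [← map_sub]
    exact h.Omega hL hY
  simp only [← mem_nullSubmodule hL]
  exact ⟨fun h₁ => (Submodule.sub_mem_iff_right _ h₁).1 hsub,
    fun h₂ => (Submodule.sub_mem_iff_left _ h₂).1 hsub⟩

theorem annihilator_subset_sub_smul (hL : IsIsotropic L) {ψ f : 𝓢(Fin n → ℝ, ℂ)}
    (h : annihilator L μ ψ ⊆ annihilator L μ f) (b : ℂ) :
    annihilator L μ ψ ⊆ annihilator L μ (f - b • ψ) := fun Y hY => by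
  refine ⟨hY.1, (mem_nullSubmodule hL).1 ?_⟩
  rw [map_sub, map_smul]
  exact sub_mem (h hY).2 (Submodule.smul_mem _ b hY.2)

theorem exists_physEquiv_smul_gaussian (hL : IsIsotropic L) {A : Matrix (Fin n) (Fin n) ℂ}
    (hA : ImPos A) {ψ : 𝓢(Fin n → ℝ, ℂ)} (h : hGerm L μ A hA ⊆ annihilator L μ ψ) :
    ∃ b : ℂ, PhysEquiv L μ ψ (b • gaussian A hA) := by
  have hne : physInner L μ (gaussian A hA) (gaussian A hA) ≠ 0 := not_isNull_gaussian hA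
  obtain ⟨B, hB, hs, hBA⟩ := exists_isSymm_gaussian_eq hA
  rw [hGerm_eq_annihilator, ← hBA] at h
  rw [← hBA] at hne ⊢
  let b := physInner L μ (gaussian B hB) ψ / physInner L μ (gaussian B hB) (gaussian B hB)
  refine ⟨b, isNull_of_annihilator_subset_of_orthogonal hL hs hB
    (annihilator_subset_sub_smul hL h b) ?_⟩
  rw [sub_eq_add_neg, ← neg_smul, physInner_add_right, physInner_smul_right, neg_mul,
    div_mul_cancel₀ _ hne, add_neg_cancel]

end Annihilator

end Constrained

end

theorem lemma13 {n : ℕ}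
    (L : Submodule ℝ (Constrained.Phase ℝ n)) (hL : Constrained.IsIsotropic L)
    (μ : MeasureTheory.Measure L) [μ.IsAddHaarMeasure]
    (A₁ A₂ : Matrix (Fin n) (Fin n) ℂ)
    (hA₁ : Constrained.ImPos A₁) (hA₂ : Constrained.ImPos A₂)
    (c₁ c₂ : ℂ) (hc₁ : c₁ ≠ 0) (hc₂ : c₂ ≠ 0) :
    Constrained.hGerm L μ A₁ hA₁ = Constrained.hGerm L μ A₂ hA₂ ↔
      ∃ c : ℂ, Constrained.PhysEquiv L μ
        (c₁ • Constrained.gaussian A₁ hA₁) (c • (c₂ • Constrained.gaussian A₂ hA₂)) := by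
  constructor
  · intro hgerm
    have hsubset : Constrained.hGerm L μ A₂ hA₂
        ⊆ Constrained.annihilator L μ (c₁ • Constrained.gaussian A₁ hA₁) := by
      rw [Constrained.annihilator_smul hL hc₁, ← hgerm, Constrained.hGerm_eq_annihilator]
    obtain ⟨b, hb⟩ := Constrained.exists_physEquiv_smul_gaussian hL hA₂ hsubset
    exact ⟨b / c₂, by rwa [smul_smul, div_mul_cancel₀ _ hc₂]⟩
  · rintro ⟨c, hc⟩
    have hc₀ : c ≠ 0 := by
      rintro rfl
      rw [Constrained.PhysEquiv, zero_smul, sub_zero, ← Constrained.mem_nullSubmodule hL,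
        Submodule.smul_mem_iff _ hc₁] at hc
      exact Constrained.not_isNull_gaussian hA₁ hc
    rw [Constrained.hGerm_eq_annihilator, Constrained.hGerm_eq_annihilator,
      ← Constrained.annihilator_smul hL hc₁, Constrained.annihilator_congr hL hc,
      Constrained.annihilator_smul hL hc₀, Constrained.annihilator_smul hL hc₂]
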